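/- Let $d\ge 2$ and let $\mu_0$ be the uniform distribution on the unit sphere $\mathbb{S}^{d-1}\subset\mathbb{R}^d$. Let $\mathcal{X}\subset\mathbb{R}^d$ and $\mathcal{Y}\subset[-1,1]$ be measurable, and let $\rho$ be a probability distribution on $\mathcal{X}\times\mathcal{Y}$ whose marginal $\rho_X$ on $\mathcal{X}$ is $\mu_0$. Let $\gamma\in(0,1]$ and $\lambda>0$. Let $\sigma(u)=\max\{0,u\}$ be the ReLU, and let $\sigma^{(s)}$ ($s>0$) be twice differentiable functions $\mathbb{R}\to\mathbb{R}$ with $\|(\sigma^{(s)})''\|_\infty<\infty$, $\|(\sigma^{(s)})'\|_\infty\le 2$ and $|\sigma^{(s)}(u)|\le 1+|u|$ for all $u\in\mathbb{R}$, such that, as $s\to\infty$, $\sigma^{(s)}\to\sigma$ and $(\sigma^{(s)})'\to\sigma'$ pointwise almost everywhere on $\mathbb{R}$. For $x,x'\in\mathcal{X}$ put $$k_\infty(x,x')=\mathbb{E}_{b\sim\mu_0}[\sigma(b^\top x)\sigma(b^\top x')]+(x^\top x'+\gamma^2)\,\mathbb{E}_{b\sim\mu_0}[\sigma'(b^\top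 x)\sigma'(b^\top x')],$$ let $k_\infty^{(s)}$ be the same kernel with $\sigma^{(s)}$ in place of $\sigma$, and for even $M$ put $$k_M^{(s)}(x,x')=\frac1M\sum_{r=1}^M\sigma^{(s)}(b_r^\top x)\sigma^{(s)}(b_r^\top x')+\frac{x^\top x'+\gamma^2}{M}\sum_{r=1}^M(\sigma^{(s)})'(b_r^\top x)(\sigma^{(s)})'(b_r^\top x'),$$ where $b_1,\dots,b_{M/2}$ are independent draws from $\mu_0$ and $b_{r+M/2}=b_r$. For each of these kernels $k$ let $\mathcal{H}_k$ be its reproducing kernel Hilbert space, $\Sigma_k f=\int f(X)\,k(X,\cdot)\,d\rho_X(X)$ its integral operator on $L_2(\rho_X)$, and $$g_{k,\lambda}=\operatorname*{arg\,min}_{g\in\mathcal{H}_k}\Big\{\mathbb{E}_{(X,Y)\sim\rho}\big[\tfrac12(g(X)-Y)^2\big]+\tfrac{\lambda}{2}\|g\|_{\mathcal{H}_k}^2\Big\}.$$ Write $\Sigma_M^{(s)},\Sigma_\infty^{(s)},\Sigma_\infty$ and $g_{M,\lambda}^{(s)},g_{\infty,\lambda}^{(s)},g_{\infty,\lambda}$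 for the operators and minimizers of $k_M^{(s)},k_\infty^{(s)},k_\infty$. Then these kernels are positive semidefinite, the integral operators are well defined and of trace class, the minimizers exist and are unique, and, with $s>0$ fixed in the limits $M\to\infty$ and with $\operatorname{plim}$ denoting convergence in probability (along even $M$): 1. $\operatorname{plim}_{M\to\infty}\|k_M^{(s)}-k_\infty^{(s)}\|_{L_\infty(\rho_X\otimes\rho_X)}=0$ and $\lim_{s\to\infty}\|k_\infty^{(s)}-k_\infty\|_{L_\infty(\rho_X\otimes\rho_X)}=0$; 2. $\operatorname{plim}_{M\to\infty}|\operatorname{tr}(\Sigma_M^{(s)}-\Sigma_\infty^{(s)})|=0$ and $\lim_{s\to\infty}|\operatorname{tr}(\Sigma_\infty^{(s)}-\Sigma_\infty)|=0$; 3. $\operatorname{plim}_{M\to\infty}\|g_{M,\lambda}^{(s)}-g_{\infty,\lambda}^{(s)}\|_{L_\infty(\rho_X)}=0$ and $\lim_{s\to\infty}\|g_{\infty,\lambda}^{(s)}-g_{\infty,\lambda}\|_{L_\infty(\rho_X)}=0$. -/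

import Mathlib

open MeasureTheory ProbabilityTheory Filter Topology Set
open scoped ENNReal NNReal

noncomputable section

namespace NTK

/-- Euclidean space `ℝ^d`. -/
abbrev E (d : ℕ) : Type := EuclideanSpace ℝ (Fin d)

/-- The uniform distribution on the unit sphere of `ℝ^d`: the normalized surface measure, as a
measure on `ℝ^d`. -/
def uniformSphere (d : ℕ) : Measure (E d) :=
  (((volume : Measure (E d)).toSphere univ)⁻¹ • (volume : Measure (E d)).toSphere).map Subtype.val

/-! ### Activations -/

/-- The ReLU activation. Its derivative `deriv relu u` is `1` for `u > 0` and `0` for `u < 0`;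
the value at `u = 0` is irrelevant below, since `{b | ⟪b, x⟫ = 0}` is a null set for the uniform
distribution on the sphere whenever `x ≠ 0` and `d ≥ 2`. -/
def relu (u : ℝ) : ℝ := max 0 u

/-- A twice differentiable activation with `‖σ''‖_∞ < ∞`, `‖σ'‖_∞ ≤ 2` and `|σ(u)| ≤ 1 + |u|`. -/
structure SmoothActivation (σ : ℝ → ℝ) : Prop where
  differentiable : Differentiable ℝ σ
  differentiable_deriv : Differentiable ℝ (deriv σ)
  bound_deriv2 : ∃ C : ℝ, 0 < C ∧ ∀ u, |deriv (deriv σ) u| ≤ C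
  bound_deriv : ∀ u, |deriv σ u| ≤ 2
  growth : ∀ u, |σ u| ≤ 1 + |u|

/-- A family `σ^{(s)}`, `s > 0`, of smooth activations which, together with their derivatives,
converge almost everywhere to the ReLU and its derivative as `s → ∞`. -/
structure SmoothReluApprox (σs : ℝ → ℝ → ℝ) : Prop where
  smooth : ∀ s, 0 < s → SmoothActivation (σs s)
  tendsto : ∀ᵐ u : ℝ, Tendsto (fun s => σs s u) atTop (𝓝 (relu u))
  tendsto_deriv : ∀ᵐ u : ℝ, Tendsto (fun s => deriv (σs s) u) atTop (𝓝 (deriv relu u))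

/-! ### Kernels -/

variable {d : ℕ}

/-- The neural tangent kernel `k_∞` (output weights initialized at `±1`). -/
def ntk (σ : ℝ → ℝ) (γ : ℝ) (x x' : E d) : ℝ :=
  (∫ b, σ (inner ℝ b x) * σ (inner ℝ b x') ∂(uniformSphere d)) +
    (inner ℝ x x' + γ ^ 2) *
      ∫ b, deriv σ (inner ℝ b x) * deriv σ (inner ℝ b x') ∂(uniformSphere d)

/-- The random feature kernel `k_M` with input-layer parameters `B = (b_1, …, b_M)`. -/
def rfKernel (σ : ℝ → ℝ) (γ : ℝ) {M : ℕ} (B : Fin M → E d) (x x' : E d) : ℝ :=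
  (1 / (M : ℝ)) * (∑ r, σ (inner ℝ (B r) x) * σ (inner ℝ (B r) x')) +
    ((inner ℝ x x' + γ ^ 2) / (M : ℝ)) *
      ∑ r, deriv σ (inner ℝ (B r) x) * deriv σ (inner ℝ (B r) x')

/-- Symmetric initialization of the `M = N + N` input-layer parameters:
`b_r = b_{r + N} = w_r` for `r = 1, …, N`. -/
def symInit {N : ℕ} (w : Fin N → E d) : Fin (N + N) → E d := Fin.append w w

/-- The neural tangent kernel `k_∞` on the feature space `𝒳`. -/
def kInf (𝒳 : Set (E d)) (σ : ℝ → ℝ) (γ : ℝ) (x x' : 𝒳) : ℝ := ntk σ γ (x : E d) (x' : E d)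

/-- The random feature kernel `k_M` on the feature space `𝒳`, of width `M = N + N`, at the symmetric
initialization given by the draws `w`. -/
def kM (𝒳 : Set (E d)) (σ : ℝ → ℝ) (γ : ℝ) {N : ℕ} (w : Fin N → E d) (x x' : 𝒳) : ℝ :=
  rfKernel σ γ (symInit w) (x : E d) (x' : E d)

/-! ### Integral operators and traces -/

section Operators

variable {X : Type} [MeasurableSpace X]

/-- `T` is the integral operator `f ↦ ∫ f(y) k(y, ·) dμ(y)` on `L₂(μ)`. -/
def IsIntegralOperator (k : X → X → ℝ) (μ : Measure X) (T : Lp ℝ 2 μ →L[ℝ] Lp ℝ 2 μ) : Prop :=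
  ∀ f : Lp ℝ 2 μ, (T f : X → ℝ) =ᵐ[μ] fun x => ∫ y, f y * k y x ∂μ

open Classical in
/-- The (unique) bounded operator on `L₂(μ)` given by the kernel `k`, if there is one. -/
def integralOperator (k : X → X → ℝ) (μ : Measure X) : Lp ℝ 2 μ →L[ℝ] Lp ℝ 2 μ :=
  if h : ∃ T, IsIntegralOperator k μ T then h.choose else 0

end Operators

section Trace

variable {H : Type} [NormedAddCommGroup H] [InnerProductSpace ℝ H] [CompleteSpace H]

/-- The self-adjoint operator `T` is of trace class with trace `t`: for every orthonormal basis
`(e_i)`, the series `∑ ⟪e_i, T e_i⟫` is absolutely convergent with sum `t`. -/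
structure HasTrace (T : H →L[ℝ] H) (t : ℝ) : Prop where
  isSelfAdjoint : IsSelfAdjoint T
  hasSum : ∀ (ι : Type) (e : HilbertBasis ι ℝ H), HasSum (fun i => inner ℝ (e i) (T (e i))) t

open Classical in
/-- The trace of a self-adjoint trace class operator. -/
def opTrace (T : H →L[ℝ] H) : ℝ := if h : ∃ t, HasTrace T t then h.choose else 0

end Trace

/-! ### Regularized risk minimization in the RKHS of a kernel -/

section RKHS

variable {X : Type}

/-- A real-valued kernel as an operator-valued matrix, the format in which the library constructs
the reproducing kernel Hilbert space `RKHS.OfKernel`. -/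
def kernelMatrix (k : X → X → ℝ) : Matrix X X (ℝ →L[ℝ] ℝ) :=
  Matrix.of fun x x' => k x x' • ContinuousLinearMap.id ℝ ℝ

variable [MeasurableSpace X] {𝒴 : Set ℝ}

/-- The expected risk `E[½ (g(X) - Y)²]` with values in `[0, ∞]`. -/
def risk (ρ : Measure (X × 𝒴)) (g : X → ℝ) : ℝ≥0∞ :=
  ∫⁻ p, ENNReal.ofReal (1 / 2 * (g p.1 - (p.2 : ℝ)) ^ 2) ∂ρ

/-- The regularized expected risk `𝓛(g) + (lam/2) ‖g‖²` of an element `g` of the RKHS of `k`. -/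
def regRisk (k : X → X → ℝ) [Fact (kernelMatrix k).PosSemidef] (ρ : Measure (X × 𝒴)) (lam : ℝ)
    (g : RKHS.OfKernel (kernelMatrix k)) : ℝ≥0∞ :=
  risk ρ (fun x => g x) + ENNReal.ofReal (lam / 2 * ‖g‖ ^ 2)

/-- `g : X → ℝ` is (the function given by) a minimizer of the regularized expected risk over the
RKHS of the positive semidefinite kernel `k`. -/
def IsRegMinimizer (k : X → X → ℝ) (ρ : Measure (X × 𝒴)) (lam : ℝ) (g : X → ℝ) : Prop :=
  ∃ _ : Fact (kernelMatrix k).PosSemidef, ∃ f : RKHS.OfKernel (kernelMatrix k),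
    (∀ x, f x = g x) ∧ ∀ f' : RKHS.OfKernel (kernelMatrix k),
      regRisk k ρ lam f ≤ regRisk k ρ lam f'

open Classical in
/-- The minimizer `g_λ` of the regularized expected risk over the RKHS of `k`. -/
def regMinimizer (k : X → X → ℝ) (ρ : Measure (X × 𝒴)) (lam : ℝ) : X → ℝ :=
  if h : ∃ g, IsRegMinimizer k ρ lam g then h.choose else 0

/-- The objects attached to the kernel `k` exist: the kernel is positive semidefinite, the bounded
integral operator on `L₂(ρ_X)` is well defined and of trace class, and the regularized expected risk
has exactly one minimizer over the RKHS. -/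
structure WellPosed (k : X → X → ℝ) (ρ : Measure (X × 𝒴)) (lam : ℝ) : Prop where
  posSemidef : (kernelMatrix k).PosSemidef
  isIntegralOperator : IsIntegralOperator k ρ.fst (integralOperator k ρ.fst)
  hasTrace : HasTrace (integralOperator k ρ.fst) (opTrace (integralOperator k ρ.fst))
  isRegMinimizer : IsRegMinimizer k ρ lam (regMinimizer k ρ lam)
  unique : ∀ g, IsRegMinimizer k ρ lam g → g = regMinimizer k ρ lam

end RKHS

/-! ### Distances -/

section Distances

variable {X : Type} [MeasurableSpace X]

/-- `‖k - k'‖` in `L_∞(μ ⊗ μ)`. -/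
def kernelDist (μ : Measure X) (k k' : X → X → ℝ) : ℝ≥0∞ :=
  eLpNorm (fun p : X × X => k p.1 p.2 - k' p.1 p.2) ∞ (μ.prod μ)

/-- `|tr(Σ - Σ')|` for the integral operators of `k` and `k'` on `L₂(μ)`. -/
def traceDist (μ : Measure X) (k k' : X → X → ℝ) : ℝ≥0∞ :=
  ‖opTrace (integralOperator k μ - integralOperator k' μ)‖ₑ

/-- `‖g - g'‖` in `L_∞(ρ_X)` for the regularized minimizers of `k` and `k'`. -/
def minimizerDist {𝒴 : Set ℝ} (ρ : Measure (X × 𝒴)) (lam : ℝ) (k k' : X → X → ℝ) : ℝ≥0∞ :=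
  eLpNorm (fun x => regMinimizer k ρ lam x - regMinimizer k' ρ lam x) ∞ ρ.fst

/-- `plim f_N = 0`: convergence to zero in probability. -/
def PlimZero {Ω : Type*} [MeasurableSpace Ω] (P : Measure Ω) (f : ℕ → Ω → ℝ≥0∞) : Prop :=
  ∀ ε : ℝ≥0∞, 0 < ε → Tendsto (fun N => P {ω | ε ≤ f N ω}) atTop (𝓝 0)

end Distances

end NTK

end

noncomputable section

namespace NTK

/-! ### Positive semidefinite scalar kernels -/

section Kernel

variable {X : Type}

/-! All three convergences follow from a deterministic stability principle: if two well-behaved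
kernels differ by at most `ε` at all pairs from a set of full measure, then each of the three
distances is at most a constant times `ε`. For the kernels themselves this is immediate. For the
traces, the trace of the integral operator is `∫ k(x, x) dρ_X`, because the kernels are finite sums
of feature kernels `∫ φ_b(x) φ_b(x') dν(b)`, to which Parseval applies for each `b`
(`hasSum_feature_trace`). For the minimizers (`RegularKernel.minimizerDist_le`), stationarity reads
`lam f(x) = E[(Y - f(X)) k(X, x)]`, so that `D = f - f'` solves `(lam + Σ') D = e` with `|e| ≤ ε E|Y
- f(X)| ≤ ε`. Pairing with `D` and discarding `⟪D, Σ' D⟫ ≥ 0` bounds `D` in `L₁`; since `k'` is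
bounded, inserting this into the equation bounds `D` in `L_∞`.

It remains to make the kernels uniformly close on the sphere. As `M → ∞`, the smoothed integrands
form a compact family in the continuous functions on the sphere, so Chebyshev's inequality on a
finite net suffices (`tendsto_measure_uniform_average`). As `s → ∞`, σ' is discontinuous in the
limit; instead, rotation invariance bounds the kernel difference by integrals over the law of a
single `⟪b, e⟫`, the same for all `x, x'`. This law is absolutely continuous since `d ≥ 2`, so a.e.
convergence on the line and dominated convergence apply (`SmoothReluApprox.tendsto_ntk`). -/

theorem kernelMatrix_posSemidef_iff {k : X → X → ℝ} :
    (kernelMatrix k).PosSemidef ↔ (∀ x y, k x y = k y x) ∧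
      ∀ c : X →₀ ℝ, 0 ≤ c.sum fun x a => c.sum fun y b => a * b * k x y := by
  have htfae := (RKHS.posSemidef_tfae (K := kernelMatrix k)).out 0 2
  refine htfae.trans ?_
  refine and_congr ?_ (forall_congr' fun c => ?_)
  · rw [Matrix.IsHermitian, ← Matrix.ext_iff]
    refine forall₂_congr fun x y => ?_
    have hstar : star (ContinuousLinearMap.id ℝ ℝ) = ContinuousLinearMap.id ℝ ℝ := star_one _
    rw [Matrix.conjTranspose_apply]
    constructor
    · intro h
      have := congrArg (fun T : ℝ →L[ℝ] ℝ => T 1) h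
      simpa [kernelMatrix, hstar, eq_comm] using this
    · intro h
      simp [kernelMatrix, h, hstar]
  · simp only [RCLike.re_to_real]
    rw [Finsupp.sum_comm]
    refine iff_of_eq (congrArg _ ?_)
    refine Finsupp.sum_congr fun x _ => Finsupp.sum_congr fun y _ => ?_
    simp [kernelMatrix]
    ring

/-- A Gram kernel is positive semidefinite. -/
theorem kernelMatrix_posSemidef_of_inner {F : Type*} [NormedAddCommGroup F] [InnerProductSpace ℝ F]
    {k : X → X → ℝ} (Φ : X → F) (hk : ∀ x y, k x y = inner ℝ (Φ x) (Φ y)) :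
    (kernelMatrix k).PosSemidef := by
  rw [kernelMatrix_posSemidef_iff]
  refine ⟨fun x y => by rw [hk, hk, real_inner_comm], fun c => ?_⟩
  have : (c.sum fun x a => c.sum fun y b => a * b * k x y) =
      inner ℝ (c.sum fun x a => a • Φ x) (c.sum fun x a => a • Φ x) := by
    simp only [Finsupp.sum, sum_inner, inner_sum, real_inner_smul_left, real_inner_smul_right, hk]
    exact Finset.sum_congr rfl fun x _ => Finset.sum_congr rfl fun y _ => by
      rw [real_inner_comm]; ring
  rw [this]
  exact real_inner_self_nonneg

theorem kernelMatrix_posSemidef_add {k k' : X → X → ℝ} (hk : (kernelMatrix k).PosSemidef)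
    (hk' : (kernelMatrix k').PosSemidef) :
    (kernelMatrix fun x y => k x y + k' x y).PosSemidef := by
  rw [kernelMatrix_posSemidef_iff] at *
  refine ⟨fun x y => by rw [hk.1, hk'.1], fun c => ?_⟩
  have := add_nonneg (hk.2 c) (hk'.2 c)
  simpa only [mul_add, Finsupp.sum_add] using this

variable (k : X → X → ℝ)

/-- The reproducing kernel Hilbert space of `k`. -/
abbrev Hk [Fact (kernelMatrix k).PosSemidef] : Type := RKHS.OfKernel (kernelMatrix k)

variable [hP : Fact (kernelMatrix k).PosSemidef]

/-- The kernel section `k(·, x)` as an element of the reproducing kernel Hilbert space. -/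
def kerSection (x : X) : Hk k := RKHS.kerFun (Hk k) x 1

theorem kerSection_apply (x y : X) : kerSection k x y = k y x := by
  rw [kerSection, RKHS.kerFun_apply, RKHS.OfKernel.kernel_ofKernel]
  simp [kernelMatrix]

variable {k}

theorem inner_kerSection (f : Hk k) (x : X) : inner ℝ f (kerSection k x) = f x := by
  rw [kerSection, RKHS.inner_kerFun]
  simp

theorem norm_kerSection_sq (x : X) : ‖kerSection k x‖ ^ 2 = k x x := by
  rw [← real_inner_self_eq_norm_sq, inner_kerSection, kerSection_apply]

theorem norm_kerSection_le {K : ℝ} {x : X} (h : k x x ≤ K) : ‖kerSection k x‖ ≤ √K := by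
  refine Real.le_sqrt_of_sq_le ?_
  rwa [norm_kerSection_sq]

theorem abs_apply_le {K : ℝ} {x : X} (h : k x x ≤ K) (f : Hk k) : |f x| ≤ √K * ‖f‖ := by
  rw [← inner_kerSection, mul_comm]
  exact (abs_real_inner_le_norm _ _).trans
    (mul_le_mul_of_nonneg_left (norm_kerSection_le h) (norm_nonneg _))

variable [MeasurableSpace X]

/-- Every element of the reproducing kernel Hilbert space of a measurable kernel is measurable. -/
theorem measurable_rkhs (hk : ∀ x, Measurable fun y => k y x) (f : Hk k) : Measurable f := by
  -- Norm convergence implies pointwise convergence, so the measurable elements form a closed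
  -- subspace; it contains the kernel sections, whose span is dense.
  let V : Submodule ℝ (Hk k) :=
    { carrier := {f | Measurable f}
      add_mem' := fun {f g} hf hg => by
        simp only [mem_ofPred_eq, RKHS.coe_add] at *
        exact hf.add hg
      zero_mem' := by
        simp only [mem_ofPred_eq, RKHS.coe_zero]
        exact measurable_const
      smul_mem' := fun c f hf => by
        simp only [mem_ofPred_eq, RKHS.coe_smul] at *
        exact hf.const_smul c }
  have hcl : IsClosed (V : Set (Hk k)) := by
    refine IsSeqClosed.isClosed fun u g hu hg => ?_
    refine measurable_of_tendsto_metrizable (f := fun n => ⇑(u n)) (fun n => hu n) ?_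
    rw [tendsto_pi_nhds]
    exact fun x => ((RKHS.continuous_eval x).tendsto g).comp hg
  have hsub : Submodule.span ℝ {RKHS.kerFun (Hk k) x v | (x) (v)} ≤ V := by
    rw [Submodule.span_le]
    rintro _ ⟨x, v, rfl⟩
    change Measurable (RKHS.kerFun (Hk k) x v)
    have : ⇑(RKHS.kerFun (Hk k) x v) = fun y => k y x * v := by
      ext y
      rw [RKHS.kerFun_apply, RKHS.OfKernel.kernel_ofKernel]
      simp [kernelMatrix]
    rw [this]
    exact (hk x).mul_const v
  have := Submodule.topologicalClosure_minimal _ hsub hcl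
  rw [RKHS.kerFun_dense] at this
  exact this (Submodule.mem_top)

end Kernel

section Bounds

variable {X : Type}

theorem kernel_diag_nonneg {k : X → X → ℝ} (hP : (kernelMatrix k).PosSemidef) (x : X) : 0 ≤ k x x := by
  have : Fact (kernelMatrix k).PosSemidef := ⟨hP⟩
  rw [← norm_kerSection_sq (k := k)]
  positivity

/-- Cauchy–Schwarz for two kernel sections. -/
theorem abs_kernel_le {k : X → X → ℝ} (hP : (kernelMatrix k).PosSemidef) {K : ℝ} {x y : X} (hx : k x x ≤ K)
    (hy : k y y ≤ K) : |k x y| ≤ K := by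
  have : Fact (kernelMatrix k).PosSemidef := ⟨hP⟩
  rw [← kerSection_apply k]
  refine (abs_apply_le hx _).trans ?_
  refine (mul_le_mul_of_nonneg_left (norm_kerSection_le hy) (Real.sqrt_nonneg _)).trans ?_
  rw [Real.mul_self_sqrt ((kernel_diag_nonneg hP x).trans hx)]

end Bounds

/-! ### The inclusion of the reproducing kernel Hilbert space into `L₂` -/

section Inclusion

variable {X Z : Type} [MeasurableSpace X] [MeasurableSpace Z] {k : X → X → ℝ}
  [hP : Fact (kernelMatrix k).PosSemidef] {ρ : Measure Z} [IsFiniteMeasure ρ] {π : Z → X} {K : ℝ}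

/-- The map `π` lets one construction serve twice: `π = id` for integral operators on `L₂(ρ_X)`, and
`π = Prod.fst` for least squares in `L₂(ρ)`, where the labels live. -/
theorem memLp_rkhs_comp (hk : ∀ x, Measurable fun y => k y x) (hπ : Measurable π)
    (hK : ∀ᵐ z ∂ρ, k (π z) (π z) ≤ K) (f : Hk k) (p : ℝ≥0∞) : MemLp (fun z => f (π z)) p ρ :=
  MemLp.of_bound ((measurable_rkhs hk f).comp hπ).aestronglyMeasurable (√K * ‖f‖)
    (hK.mono fun _ hz => abs_apply_le hz f)

/-- The map `f ↦ f ∘ π` from the reproducing kernel Hilbert space to `L₂`. -/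
def toL2 (hk : ∀ x, Measurable fun y => k y x) (hπ : Measurable π)
    (hK : ∀ᵐ z ∂ρ, k (π z) (π z) ≤ K) : Hk k →L[ℝ] Lp ℝ 2 ρ :=
  LinearMap.mkContinuous
    { toFun := fun f => (memLp_rkhs_comp hk hπ hK f 2).toLp
      map_add' := fun f g => by
        rw [← MemLp.toLp_add]
        exact MemLp.toLp_congr _ _ (by simp [RKHS.coe_add]; rfl)
      map_smul' := fun c f => by
        rw [RingHom.id_apply, ← MemLp.toLp_const_smul]
        exact MemLp.toLp_congr _ _ (by simp [RKHS.coe_smul]; rfl) }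
    (ρ.real univ ^ (2⁻¹ : ℝ) * √K) fun f => by
      rw [mul_assoc]
      have := Lp.norm_le_of_ae_bound (f := (memLp_rkhs_comp hk hπ hK f 2).toLp)
        (C := √K * ‖f‖) (by positivity) (by
          filter_upwards [hK, (memLp_rkhs_comp hk hπ hK f 2).coeFn_toLp] with z hz h
          rw [h]
          exact abs_apply_le hz f)
      simp only [ENNReal.toReal_ofNat] at this
      exact this

theorem coeFn_toL2 (hk : ∀ x, Measurable fun y => k y x) (hπ : Measurable π)
    (hK : ∀ᵐ z ∂ρ, k (π z) (π z) ≤ K) (f : Hk k) :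
    (toL2 hk hπ hK f : Z → ℝ) =ᵐ[ρ] fun z => f (π z) :=
  (memLp_rkhs_comp hk hπ hK f 2).coeFn_toLp

theorem adjoint_toL2_apply (hk : ∀ x, Measurable fun y => k y x) (hπ : Measurable π)
    (hK : ∀ᵐ z ∂ρ, k (π z) (π z) ≤ K) (g : Lp ℝ 2 ρ) (x : X) :
    (toL2 hk hπ hK).adjoint g x = ∫ z, g z * k (π z) x ∂ρ := by
  rw [← inner_kerSection, ContinuousLinearMap.adjoint_inner_left, L2.inner_def]
  refine integral_congr_ae ?_
  filter_upwards [coeFn_toL2 hk hπ hK (kerSection k x)] with z hz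
  rw [hz, kerSection_apply]
  simp [mul_comm]

end Inclusion

/-! ### Integral operators -/

section Operator

variable {X : Type} [MeasurableSpace X] {k k' : X → X → ℝ} {μ : Measure X}

theorem IsIntegralOperator.eq {T T' : Lp ℝ 2 μ →L[ℝ] Lp ℝ 2 μ} (h : IsIntegralOperator k μ T)
    (h' : IsIntegralOperator k μ T') : T = T' := by
  ext1 f
  exact Lp.ext ((h f).trans (h' f).symm)

theorem IsIntegralOperator.integralOperator_eq {T : Lp ℝ 2 μ →L[ℝ] Lp ℝ 2 μ}
    (h : IsIntegralOperator k μ T) : integralOperator k μ = T := by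
  have h' : ∃ T, IsIntegralOperator k μ T := ⟨T, h⟩
  rw [integralOperator, dif_pos h']
  exact h'.choose_spec.eq h

/-- By the reproducing property, the adjoint of the inclusion `S` integrates against the kernel. The
factorization `S S*` yields boundedness, self-adjointness and positivity at once. -/
theorem isIntegralOperator_toL2 [IsFiniteMeasure μ] [Fact (kernelMatrix k).PosSemidef] {K : ℝ}
    (hk : ∀ x, Measurable fun y => k y x) (hK : ∀ᵐ x ∂μ, k x x ≤ K) :
    IsIntegralOperator k μ
      ((toL2 hk measurable_id hK) ∘L (toL2 hk measurable_id hK).adjoint) := by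
  intro f
  filter_upwards [coeFn_toL2 hk measurable_id hK ((toL2 hk measurable_id hK).adjoint f)] with x hx
  rw [ContinuousLinearMap.comp_apply, hx, adjoint_toL2_apply]
  rfl

end Operator

/-! ### Uniqueness and additivity of the trace. -/

section Trace

variable {H : Type} [NormedAddCommGroup H] [InnerProductSpace ℝ H] [CompleteSpace H]

theorem HasTrace.opTrace_eq {T : H →L[ℝ] H} {t : ℝ} (h : HasTrace T t) : opTrace T = t := by
  have h' : ∃ t, HasTrace T t := ⟨t, h⟩
  rw [opTrace, dif_pos h']
  -- Some Hilbert basis must exist, or the condition over all bases would be vacuous and would not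
  -- determine the trace.
  obtain ⟨w, b, -⟩ := exists_hilbertBasis ℝ H
  exact (h'.choose_spec.hasSum _ b).unique (h.hasSum _ b)

theorem HasTrace.add {T T' : H →L[ℝ] H} {t t' : ℝ} (h : HasTrace T t) (h' : HasTrace T' t') :
    HasTrace (T + T') (t + t') where
  isSelfAdjoint := h.isSelfAdjoint.add h'.isSelfAdjoint
  hasSum ι e := by
    simpa [inner_add_right] using (h.hasSum ι e).add (h'.hasSum ι e)

theorem HasTrace.sub {T T' : H →L[ℝ] H} {t t' : ℝ} (h : HasTrace T t) (h' : HasTrace T' t') :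
    HasTrace (T - T') (t - t') where
  isSelfAdjoint := h.isSelfAdjoint.sub h'.isSelfAdjoint
  hasSum ι e := by
    simpa [inner_sub_right] using (h.hasSum ι e).sub (h'.hasSum ι e)

end Trace

/-! ### Regularized least squares in Hilbert spaces -/

section LeastSquares

variable {H G : Type*} [NormedAddCommGroup H] [InnerProductSpace ℝ H] [CompleteSpace H]
  [NormedAddCommGroup G] [InnerProductSpace ℝ G] [CompleteSpace G]

/-- The normal equation of regularized least squares has a solution. -/
theorem exists_normal_equation (A : H →L[ℝ] G) (y : G) {lam : ℝ} (hlam : 0 < lam) :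
    ∃ f : H, ∀ h, inner ℝ (A f - y) (A h) + lam * inner ℝ f h = 0 := by
  -- Lax–Milgram: the form of `A*A + lam` is coercive with constant `lam`.
  let B : H →L[ℝ] H →L[ℝ] ℝ := (innerSL ℝ) ∘L (A.adjoint ∘L A + lam • ContinuousLinearMap.id ℝ H)
  have hB : ∀ f h, B f h = inner ℝ (A f) (A h) + lam * inner ℝ f h := fun f h => by
    change inner ℝ (A.adjoint (A f) + lam • f) h = _
    rw [inner_add_left, ContinuousLinearMap.adjoint_inner_left, real_inner_smul_left]
  have hc : IsCoercive B := by
    refine ⟨lam, hlam, fun f => ?_⟩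
    rw [hB, real_inner_self_eq_norm_mul_norm, real_inner_self_eq_norm_mul_norm]
    nlinarith [mul_self_nonneg ‖A f‖]
  refine ⟨hc.continuousLinearEquivOfBilin.symm (A.adjoint y), fun h => ?_⟩
  have h1 := hc.continuousLinearEquivOfBilin_apply
    (hc.continuousLinearEquivOfBilin.symm (A.adjoint y)) h
  rw [ContinuousLinearEquiv.apply_symm_apply, hB, ContinuousLinearMap.adjoint_inner_left] at h1
  rw [inner_sub_left]
  linarith

end LeastSquares

/-- Completing the square at a stationary point: the cross term vanishes by `hf`. The nonnegative
remainder gives minimality and uniqueness, and the case `g = 0` bounds the residual. -/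
theorem least_squares_identity {H G : Type*} [NormedAddCommGroup H] [InnerProductSpace ℝ H]
    [NormedAddCommGroup G] [InnerProductSpace ℝ G] (A : H →L[ℝ] G) (y : G) {lam : ℝ} {f : H}
    (hf : ∀ h, inner ℝ (A f - y) (A h) + lam * inner ℝ f h = 0) (g : H) :
    1 / 2 * ‖A g - y‖ ^ 2 + lam / 2 * ‖g‖ ^ 2 = 1 / 2 * ‖A f - y‖ ^ 2 + lam / 2 * ‖f‖ ^ 2
      + (1 / 2 * ‖A (g - f)‖ ^ 2 + lam / 2 * ‖g - f‖ ^ 2) := by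
  have h1 : A g - y = (A f - y) + A (g - f) := by rw [map_sub]; abel
  have h2 : g = f + (g - f) := by abel
  have h3 : ‖g‖ ^ 2 = ‖f‖ ^ 2 + 2 * inner ℝ f (g - f) + ‖g - f‖ ^ 2 := by
    conv_lhs => rw [h2]
    exact norm_add_sq_real _ _
  rw [h1, norm_add_sq_real, h3]
  linear_combination hf (g - f)

/-! ### Regular kernels and well-posedness -/

section Regular

variable {X : Type} [MeasurableSpace X]

/-- A measurable positive semidefinite kernel with essentially bounded diagonal whose integral
operator has trace `∫ k(x, x) dμ(x)`. -/
structure RegularKernel (μ : Measure X) (k : X → X → ℝ) : Prop where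
  posSemidef : (kernelMatrix k).PosSemidef
  measurable : Measurable (Function.uncurry k)
  diag_bounded : ∃ K : ℝ, ∀ᵐ x ∂μ, k x x ≤ K
  hasTrace : HasTrace (integralOperator k μ) (∫ x, k x x ∂μ)

variable {μ : Measure X} {k k' : X → X → ℝ} {𝒴 : Set ℝ}

theorem RegularKernel.measurable_left (h : RegularKernel μ k) (x : X) :
    Measurable fun y => k y x :=
  h.measurable.comp (measurable_id.prodMk measurable_const)

theorem RegularKernel.measurable_diag (h : RegularKernel μ k) : Measurable fun x => k x x :=
  h.measurable.comp (measurable_id.prodMk measurable_id)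

theorem RegularKernel.isIntegralOperator [IsFiniteMeasure μ] (h : RegularKernel μ k) :
    IsIntegralOperator k μ (integralOperator k μ) := by
  have : Fact (kernelMatrix k).PosSemidef := ⟨h.posSemidef⟩
  obtain ⟨K, hK⟩ := h.diag_bounded
  have hT := isIntegralOperator_toL2 h.measurable_left hK
  rwa [hT.integralOperator_eq]

theorem RegularKernel.integrable_diag [IsFiniteMeasure μ] (h : RegularKernel μ k) :
    Integrable (fun x => k x x) μ := by
  obtain ⟨K, hK⟩ := h.diag_bounded
  refine Integrable.of_bound h.measurable_diag.aestronglyMeasurable K (hK.mono fun x hx => ?_)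
  rwa [Real.norm_of_nonneg (kernel_diag_nonneg h.posSemidef x)]

variable {ρ : Measure (X × 𝒴)} {lam : ℝ}

theorem ae_fst {p : X → Prop} (h : ∀ᵐ x ∂ρ.fst, p x) : ∀ᵐ z ∂ρ, p z.1 :=
  ae_of_ae_map measurable_fst.aemeasurable h

theorem norm_sub_toLp_sq {f g : X × 𝒴 → ℝ} (hf : MemLp f 2 ρ) (hg : MemLp g 2 ρ) :
    ‖hf.toLp - hg.toLp‖ ^ 2 = ∫ z, (f z - g z) ^ 2 ∂ρ := by
  rw [← real_inner_self_eq_norm_sq, ← MemLp.toLp_sub, L2.inner_def]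
  refine integral_congr_ae ?_
  filter_upwards [(hf.sub hg).coeFn_toLp] with z hz
  rw [hz]
  simp [sq]

variable [IsProbabilityMeasure ρ]

theorem memLp_label (h𝒴 : 𝒴 ⊆ Icc (-1) 1) (p : ℝ≥0∞) : MemLp (fun z : X × 𝒴 => (z.2 : ℝ)) p ρ :=
  MemLp.of_bound (measurable_subtype_coe.comp measurable_snd).aestronglyMeasurable 1
    (ae_of_all _ fun z => abs_le.2 (h𝒴 z.2.2))

/-- The regularized risk has a unique minimizer, which satisfies the stationarity equation. -/
theorem RegularKernel.regMinimizer_spec (h : RegularKernel ρ.fst k) (h𝒴 : 𝒴 ⊆ Icc (-1) 1)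
    (hlam : 0 < lam) :
    IsRegMinimizer k ρ lam (regMinimizer k ρ lam) ∧
    (∀ g, IsRegMinimizer k ρ lam g → g = regMinimizer k ρ lam) ∧
    (∀ p, MemLp (regMinimizer k ρ lam) p ρ.fst) ∧
    (∀ x, lam * regMinimizer k ρ lam x = ∫ z, (z.2 - regMinimizer k ρ lam z.1) * k z.1 x ∂ρ) ∧
    ∫ z, (regMinimizer k ρ lam z.1 - z.2) ^ 2 ∂ρ ≤ 1 := by
  have : Fact (kernelMatrix k).PosSemidef := ⟨h.posSemidef⟩
  obtain ⟨K, hK⟩ := h.diag_bounded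
  have hK' := ae_fst hK
  set A : Hk k →L[ℝ] Lp ℝ 2 ρ := toL2 h.measurable_left measurable_fst hK'
  have hf2 : ∀ f : Hk k, MemLp (fun z : X × 𝒴 => f z.1) 2 ρ := fun f =>
    memLp_rkhs_comp h.measurable_left measurable_fst hK' f 2
  have hAf : ∀ f : Hk k, A f = (hf2 f).toLp := fun f => rfl
  have hy2 : MemLp (fun z : X × 𝒴 => (z.2 : ℝ)) 2 ρ := memLp_label h𝒴 2
  have hrisk : ∀ f : Hk k, regRisk k ρ lam f =
      ENNReal.ofReal (1 / 2 * ‖A f - hy2.toLp‖ ^ 2 + lam / 2 * ‖f‖ ^ 2) := fun f => by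
    rw [regRisk, risk, ENNReal.ofReal_add (by positivity) (by positivity), hAf,
      norm_sub_toLp_sq (hf2 f) hy2, ← integral_const_mul,
      ofReal_integral_eq_lintegral_ofReal
        (f := fun z : X × 𝒴 => 1 / 2 * (f z.1 - (z.2 : ℝ)) ^ 2) (((hf2 f).sub hy2).integrable_sq.const_mul _)
        (ae_of_all _ fun z => mul_nonneg (by norm_num) (sq_nonneg _))]
  obtain ⟨f, hf⟩ := exists_normal_equation A hy2.toLp hlam
  have hid := least_squares_identity A hy2.toLp hf
  have hmin : IsRegMinimizer k ρ lam f := by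
    refine ⟨this, f, fun _ => rfl, fun g => ?_⟩
    rw [hrisk, hrisk]
    refine ENNReal.ofReal_le_ofReal ?_
    rw [hid g]
    exact le_add_of_nonneg_right (by positivity)
  have huniq : ∀ g, IsRegMinimizer k ρ lam g → g = f := by
    rintro g ⟨_, g', hg, hg'⟩
    have h1 := hg' f
    rw [hrisk, hrisk, ENNReal.ofReal_le_ofReal_iff (by positivity), hid g'] at h1
    have h2 : lam / 2 * ‖g' - f‖ ^ 2 ≤ 0 := by
      have : 0 ≤ 1 / 2 * ‖A (g' - f)‖ ^ 2 := by positivity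
      linarith
    have h3 : ‖g' - f‖ = 0 := by
      by_contra h0
      have : 0 < lam / 2 * ‖g' - f‖ ^ 2 := by positivity
      linarith
    rw [norm_eq_zero, sub_eq_zero] at h3
    ext x
    rw [← hg x, h3]
  have hex : ∃ g, IsRegMinimizer k ρ lam g := ⟨f, hmin⟩
  have heq : regMinimizer k ρ lam = f := by
    rw [regMinimizer, dif_pos hex]
    exact huniq _ hex.choose_spec
  rw [heq]
  refine ⟨hmin, huniq, fun p => ?_, fun x => ?_, ?_⟩
  · exact memLp_rkhs_comp h.measurable_left measurable_id hK f p
  -- Testing the normal equation against a kernel section turns it into a pointwise equation.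
  · have h1 := hf (kerSection k x)
    rw [inner_kerSection, hAf, hAf, ← MemLp.toLp_sub, L2.inner_def] at h1
    have h2 : ∫ z, inner ℝ (((hf2 f).sub hy2).toLp _ z) ((hf2 (kerSection k x)).toLp _ z) ∂ρ =
        - ∫ z, (z.2 - f z.1) * k z.1 x ∂ρ := by
      rw [← integral_neg]
      refine integral_congr_ae ?_
      filter_upwards [((hf2 f).sub hy2).coeFn_toLp, (hf2 (kerSection k x)).coeFn_toLp] with z hz hz'
      rw [hz, hz', kerSection_apply]
      simp only [Pi.sub_apply, RCLike.inner_apply, conj_trivial]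
      ring
    rw [h2] at h1
    linarith
  -- Comparison with the zero function, whose squared error is at most `1` because the labels lie in
  -- `[-1, 1]`.
  · have h1 := hid 0
    have h2 : ‖A 0 - hy2.toLp‖ ^ 2 ≤ 1 := by
      rw [hAf, norm_sub_toLp_sq]
      calc _ ≤ ∫ z : X × 𝒴, (1 : ℝ) ∂ρ := by
            refine integral_mono ((hf2 0).sub hy2).integrable_sq (integrable_const _) fun z => ?_
            simp only [RKHS.coe_zero, Pi.zero_apply, zero_sub, neg_sq]
            exact (sq_le_one_iff_abs_le_one _).2 (abs_le.2 (h𝒴 z.2.2))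
        _ = 1 := by simp
    rw [hAf f, norm_sub_toLp_sq (hf2 f) hy2] at h1
    have h3 : 0 ≤ 1 / 2 * ‖A (0 - f)‖ ^ 2 + lam / 2 * ‖0 - f‖ ^ 2 := by positivity
    have h4 : 0 ≤ lam / 2 * ‖f‖ ^ 2 := by positivity
    have h5 : lam / 2 * ‖(0 : Hk k)‖ ^ 2 = 0 := by simp
    linarith

theorem RegularKernel.wellPosed (h : RegularKernel ρ.fst k) (h𝒴 : 𝒴 ⊆ Icc (-1) 1)
    (hlam : 0 < lam) : WellPosed k ρ lam where
  posSemidef := h.posSemidef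
  isIntegralOperator := h.isIntegralOperator
  hasTrace := by
    rw [h.hasTrace.opTrace_eq]
    exact h.hasTrace
  isRegMinimizer := (h.regMinimizer_spec h𝒴 hlam).1
  unique := (h.regMinimizer_spec h𝒴 hlam).2.1

/-! ### Stability -/

theorem kernelDist_le [SFinite μ] {G : X → Prop} (hG : ∀ᵐ x ∂μ, G x) {ε : ℝ}
    (hε : ∀ x y, G x → G y → |k x y - k' x y| ≤ ε) :
    kernelDist μ k k' ≤ ENNReal.ofReal ε := by
  rw [kernelDist, eLpNorm_exponent_top]
  refine eLpNormEssSup_le_of_ae_bound ?_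
  filter_upwards [Measure.quasiMeasurePreserving_fst.ae hG,
    Measure.quasiMeasurePreserving_snd.ae hG] with p h1 h2
  exact hε _ _ h1 h2

theorem RegularKernel.traceDist_le [IsProbabilityMeasure μ] (h : RegularKernel μ k)
    (h' : RegularKernel μ k') {G : X → Prop} (hG : ∀ᵐ x ∂μ, G x) {ε : ℝ}
    (hε : ∀ x y, G x → G y → |k x y - k' x y| ≤ ε) :
    traceDist μ k k' ≤ ENNReal.ofReal ε := by
  rw [traceDist, (h.hasTrace.sub h'.hasTrace).opTrace_eq,
    ← integral_sub h.integrable_diag h'.integrable_diag, ← ofReal_norm]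
  refine ENNReal.ofReal_le_ofReal ?_
  have := norm_integral_le_of_norm_le_const (μ := μ) (f := fun x => k x x - k' x x) (C := ε)
    (hG.mono fun x hx => hε x x hx hx)
  simpa using this

theorem RegularKernel.integralOperator_toLp [IsFiniteMeasure μ] (h : RegularKernel μ k)
    {D : X → ℝ} (hD : MemLp D 2 μ) :
    (integralOperator k μ (hD.toLp D) : X → ℝ) =ᵐ[μ] fun x => ∫ y, D y * k y x ∂μ := by
  filter_upwards [h.isIntegralOperator (hD.toLp D)] with x hx
  rw [hx]
  exact integral_congr_ae (by filter_upwards [hD.coeFn_toLp] with y hy; rw [hy])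

/-- The quadratic form of `S S*` at `D` is `‖S* D‖²`. -/
theorem RegularKernel.integral_quadratic_nonneg [IsFiniteMeasure μ] (h : RegularKernel μ k)
    {D : X → ℝ} (hD : MemLp D 2 μ) : 0 ≤ ∫ x, D x * ∫ y, D y * k y x ∂μ ∂μ := by
  have : Fact (kernelMatrix k).PosSemidef := ⟨h.posSemidef⟩
  obtain ⟨K, hK⟩ := h.diag_bounded
  set S := toL2 h.measurable_left measurable_id hK
  have hT : integralOperator k μ = S ∘L S.adjoint :=
    (isIntegralOperator_toL2 h.measurable_left hK).integralOperator_eq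
  have h1 : 0 ≤ inner ℝ (hD.toLp D) (integralOperator k μ (hD.toLp D)) := by
    rw [hT, ContinuousLinearMap.comp_apply, ← ContinuousLinearMap.adjoint_inner_left]
    exact real_inner_self_nonneg
  rw [L2.inner_def] at h1
  refine h1.trans_eq (integral_congr_ae ?_)
  filter_upwards [hD.coeFn_toLp, h.integralOperator_toLp hD] with x hx hx'
  rw [hx', hx]
  simp [mul_comm]

theorem integral_abs_sq_le {Z : Type*} [MeasurableSpace Z] {ν : Measure Z} [IsProbabilityMeasure ν]
    {f : Z → ℝ} (hf : MemLp f 2 ν) : (∫ z, |f z| ∂ν) ^ 2 ≤ ∫ z, f z ^ 2 ∂ν := by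
  have h := variance_nonneg |f| ν
  rw [variance_eq_sub hf.abs] at h
  simp only [Pi.pow_apply, Pi.abs_apply, sq_abs] at h
  linarith

/-- Only `k'` needs the explicit bound `K`, so the constant does not depend on the varying kernel
`k`. The `L₁` bound `ε / lam` becomes a sup bound through `lam |D(x)| ≤ ε + K ε / lam`. -/
theorem RegularKernel.minimizerDist_le (h : RegularKernel ρ.fst k) (h' : RegularKernel ρ.fst k')
    (h𝒴 : 𝒴 ⊆ Icc (-1) 1) (hlam : 0 < lam) {G : X → Prop} (hG : ∀ᵐ x ∂ρ.fst, G x) {ε K : ℝ}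
    (hK : ∀ x, G x → k' x x ≤ K) (hε : ∀ x y, G x → G y → |k x y - k' x y| ≤ ε) :
    minimizerDist ρ lam k k' ≤ ENNReal.ofReal ((1 + K / lam) / lam * ε) := by
  obtain ⟨-, -, hL, hst, hr⟩ := h.regMinimizer_spec h𝒴 hlam
  obtain ⟨-, -, hL', hst', -⟩ := h'.regMinimizer_spec h𝒴 hlam
  set f := regMinimizer k ρ lam
  set f' := regMinimizer k' ρ lam
  set μ := ρ.fst with hμ
  have hmp : MeasurePreserving (Prod.fst : X × 𝒴 → X) ρ μ := ⟨measurable_fst, rfl⟩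
  obtain ⟨x₀, hx₀⟩ := hG.exists
  have hε0 : 0 ≤ ε := (abs_nonneg _).trans (hε x₀ x₀ hx₀ hx₀)
  have hGρ : ∀ᵐ z ∂ρ, G z.1 := ae_fst hG
  have hkb : ∀ x y, G x → G y → |k' x y| ≤ K := fun x y hx hy =>
    abs_kernel_le h'.posSemidef (hK x hx) (hK y hy)
  have hK0 : 0 ≤ K := (abs_nonneg _).trans (hkb x₀ x₀ hx₀ hx₀)
  set D : X → ℝ := fun x => f x - f' x with hDdef
  have hD : MemLp D 2 μ := (hL 2).sub (hL' 2)
  have hD1 : Integrable D μ := memLp_one_iff_integrable.1 ((hL 1).sub (hL' 1))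
  have hfρ : MemLp (fun z : X × 𝒴 => f z.1) 2 ρ := (hL 2).comp_measurePreserving hmp
  have hR : MemLp (fun z : X × 𝒴 => (z.2 : ℝ) - f z.1) 2 ρ := (memLp_label h𝒴 2).sub hfρ
  have hR1 := hR.integrable one_le_two
  have hR' : ∫ z : X × 𝒴, |(z.2 : ℝ) - f z.1| ∂ρ ≤ 1 := by
    have h1 := integral_abs_sq_le hR
    have h2 : ∫ z : X × 𝒴, ((z.2 : ℝ) - f z.1) ^ 2 ∂ρ = ∫ z : X × 𝒴, (f z.1 - z.2) ^ 2 ∂ρ :=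
      integral_congr_ae (ae_of_all _ fun z => by ring)
    have h3 := h1.trans (h2.trans_le hr)
    exact (sq_le_one_iff₀ (integral_nonneg fun z => abs_nonneg _)).1 h3
  have hbd : ∀ {g : X × 𝒴 → ℝ} {q : X → ℝ} {C : ℝ}, Integrable g ρ → Measurable q →
      (∀ y, G y → |q y| ≤ C) → Integrable (fun z => g z * q z.1) ρ := fun hg hq hC =>
    hg.mul_bdd (hq.comp measurable_fst).aestronglyMeasurable (hGρ.mono fun z hz => hC _ hz)
  -- the residual equation `lam D + T' D = e`
  set e : X → ℝ := fun x => ∫ z, (z.2 - f z.1) * (k z.1 x - k' z.1 x) ∂ρ with he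
  have heb : ∀ x, G x → |e x| ≤ ε := fun x hx => by
    calc |e x| ≤ ∫ z, |(z.2 - f z.1) * (k z.1 x - k' z.1 x)| ∂ρ := abs_integral_le_integral_abs
      _ ≤ ∫ z : X × 𝒴, |(z.2 : ℝ) - f z.1| * ε ∂ρ := by
        refine integral_mono_of_nonneg (ae_of_all _ fun z => abs_nonneg _)
          (hR1.abs.mul_const _) (hGρ.mono fun z hz => ?_)
        simp only [abs_mul]
        exact mul_le_mul_of_nonneg_left (hε _ _ hz hx) (abs_nonneg _)
      _ ≤ ε := by
        rw [integral_mul_const]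
        exact mul_le_of_le_one_left hε0 hR'
  have heq : ∀ x, G x → lam * D x = e x - ∫ y, D y * k' y x ∂μ := fun x hx => by
    have i1 : Integrable (fun z : X × 𝒴 => ((z.2 : ℝ) - f z.1) * (k z.1 x - k' z.1 x)) ρ :=
      hbd hR1 ((h.measurable_left x).sub (h'.measurable_left x)) fun y hy => hε y x hy hx
    have i2 : Integrable (fun z : X × 𝒴 => D z.1 * k' z.1 x) ρ :=
      hbd (hmp.integrable_comp_of_integrable hD1) (h'.measurable_left x) fun y hy => hkb y x hy hx
    have i3 : Integrable (fun z : X × 𝒴 => ((z.2 : ℝ) - f z.1) * k' z.1 x) ρ :=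
      hbd hR1 (h'.measurable_left x) fun y hy => hkb y x hy hx
    have e1 : ∫ y, D y * k' y x ∂μ = ∫ z : X × 𝒴, D z.1 * k' z.1 x ∂ρ := by
      have hm : AEStronglyMeasurable (fun y => D y * k' y x) μ :=
        hD.1.mul (h'.measurable_left x).aestronglyMeasurable
      rw [← hmp.map_eq] at hm ⊢
      exact integral_map measurable_fst.aemeasurable hm
    have e2 : lam * D x = lam * f x - lam * f' x := by rw [hDdef]; ring
    rw [e2, hst x, hst' x, e1, he]
    have e3 : ∫ z : X × 𝒴, ((z.2 : ℝ) - f z.1) * k z.1 x ∂ρ =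
        ∫ z : X × 𝒴, ((z.2 : ℝ) - f z.1) * (k z.1 x - k' z.1 x) ∂ρ +
        ∫ z : X × 𝒴, ((z.2 : ℝ) - f z.1) * k' z.1 x ∂ρ := by
      rw [← integral_add i1 i3]
      exact integral_congr_ae (ae_of_all _ fun z => by ring)
    have e4 : ∫ z : X × 𝒴, ((z.2 : ℝ) - f' z.1) * k' z.1 x ∂ρ =
        ∫ z : X × 𝒴, ((z.2 : ℝ) - f z.1) * k' z.1 x ∂ρ + ∫ z : X × 𝒴, D z.1 * k' z.1 x ∂ρ := by
      rw [← integral_add i3 i2]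
      exact integral_congr_ae (ae_of_all _ fun z => by simp only [hDdef]; ring)
    rw [e3, e4]
    ring
  -- the `L₁` estimate
  have hDabs : ∫ x, |D x| ∂μ ≤ ε / lam := by
    have hpos := h'.integral_quadratic_nonneg hD
    have hDT : Integrable (fun x => D x * ∫ y, D y * k' y x ∂μ) μ :=
      hD.integrable_mul ((Lp.memLp _).ae_eq (h'.integralOperator_toLp hD))
    have h1 : ∫ x, lam * D x ^ 2 ∂μ ≤
        ∫ x, (ε * |D x| - D x * ∫ y, D y * k' y x ∂μ) ∂μ := by
      refine integral_mono_ae (hD.integrable_sq.const_mul _)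
        ((hD1.abs.const_mul _).sub hDT) ?_
      · filter_upwards [hG] with x hx
        have h2 : D x * (lam * D x) = D x * e x - D x * ∫ y, D y * k' y x ∂μ := by
          rw [heq x hx]; ring
        have h3 : D x * e x ≤ ε * |D x| := by
          refine (le_abs_self _).trans ?_
          rw [abs_mul, mul_comm]
          exact mul_le_mul_of_nonneg_right (heb x hx) (abs_nonneg _)
        linarith
    rw [integral_sub (hD1.abs.const_mul _) hDT, integral_const_mul, integral_const_mul] at h1
    have h2 := mul_le_mul_of_nonneg_left (integral_abs_sq_le hD) hlam.le
    have h3 : 0 ≤ ∫ x, |D x| ∂μ := integral_nonneg fun x => abs_nonneg _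
    rw [le_div_iff₀ hlam]
    -- At this point `lam (∫ |D|)² ≤ ε ∫ |D|`; cancelling a factor requires `∫ |D| > 0`.
    rcases h3.eq_or_lt with h0 | h0
    · rw [← h0, zero_mul]
      exact hε0
    · refine le_of_mul_le_mul_right ?_ h0
      linarith
  rw [minimizerDist, eLpNorm_exponent_top]
  refine eLpNormEssSup_le_of_ae_bound (hG.mono fun x hx => ?_)
  have h1 : |∫ y, D y * k' y x ∂μ| ≤ K * (ε / lam) := by
    calc _ ≤ ∫ y, |D y * k' y x| ∂μ := abs_integral_le_integral_abs
      _ ≤ ∫ y, |D y| * K ∂μ := by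
        refine integral_mono_of_nonneg (ae_of_all _ fun z => abs_nonneg _)
          (hD1.abs.mul_const _) (hG.mono fun y hy => ?_)
        simp only [abs_mul]
        exact mul_le_mul_of_nonneg_left (hkb _ _ hy hx) (abs_nonneg _)
      _ ≤ K * (ε / lam) := by
        rw [integral_mul_const, mul_comm]
        exact mul_le_mul_of_nonneg_left hDabs hK0
  have h2 : lam * |D x| ≤ ε + K * (ε / lam) := by
    rw [← abs_of_pos hlam, ← abs_mul, abs_of_pos hlam, heq x hx]
    exact (abs_sub _ _).trans (add_le_add (heb x hx) h1)
  rw [Real.norm_eq_abs, show (1 + K / lam) / lam * ε = (ε + K * (ε / lam)) / lam by ring,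
    le_div_iff₀ hlam, mul_comm]
  exact h2

end Regular

/-! ### Sums of regular kernels -/

section RegularSums

variable {X : Type} [MeasurableSpace X] {μ : Measure X} {k k' : X → X → ℝ}

theorem RegularKernel.integrable_mul (h : RegularKernel μ k) {f : X → ℝ} (hf : Integrable f μ) :
    ∀ᵐ x ∂μ, Integrable (fun y => f y * k y x) μ := by
  obtain ⟨K, hK⟩ := h.diag_bounded
  filter_upwards [hK] with x hx
  exact hf.mul_bdd (h.measurable_left x).aestronglyMeasurable
    (hK.mono fun y hy => abs_kernel_le h.posSemidef hy hx)

theorem RegularKernel.zero : RegularKernel μ fun _ _ => 0 where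
  posSemidef := kernelMatrix_posSemidef_of_inner (F := ℝ) (fun _ => 0) (by simp)
  measurable := measurable_const
  diag_bounded := ⟨0, by simp⟩
  hasTrace := by
    have hT : IsIntegralOperator (fun _ _ => 0) μ (0 : Lp ℝ 2 μ →L[ℝ] Lp ℝ 2 μ) := by
      intro f
      filter_upwards [Lp.coeFn_zero ℝ 2 μ] with x hx
      rw [zero_apply, hx]
      simp
    rw [hT.integralOperator_eq]
    exact ⟨IsSelfAdjoint.zero _, by simp⟩

variable [IsFiniteMeasure μ]

theorem RegularKernel.add (h : RegularKernel μ k) (h' : RegularKernel μ k') :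
    RegularKernel μ fun x y => k x y + k' x y where
  posSemidef := kernelMatrix_posSemidef_add h.posSemidef h'.posSemidef
  measurable := h.measurable.add h'.measurable
  diag_bounded := by
    obtain ⟨K, hK⟩ := h.diag_bounded
    obtain ⟨K', hK'⟩ := h'.diag_bounded
    exact ⟨K + K', by filter_upwards [hK, hK'] with x hx hx' using add_le_add hx hx'⟩
  hasTrace := by
    have hT : IsIntegralOperator (fun x y => k x y + k' x y) μ
        (integralOperator k μ + integralOperator k' μ) := by
      intro f
      have hf := (Lp.memLp f).integrable one_le_two
      rw [add_apply]
      filter_upwards [Lp.coeFn_add (integralOperator k μ f) (integralOperator k' μ f),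
        h.isIntegralOperator f, h'.isIntegralOperator f, h.integrable_mul hf,
        h'.integrable_mul hf] with x h1 h2 h3 h4 h5
      simp only [mul_add]
      rw [h1, Pi.add_apply, h2, h3, integral_add h4 h5]
    rw [hT.integralOperator_eq, integral_add h.integrable_diag h'.integrable_diag]
    exact h.hasTrace.add h'.hasTrace

theorem RegularKernel.sum {ι : Type*} (s : Finset ι) {k : ι → X → X → ℝ}
    (h : ∀ i ∈ s, RegularKernel μ (k i)) : RegularKernel μ fun x y => ∑ i ∈ s, k i x y := by
  classical
  induction s using Finset.induction_on with
  | empty => simpa using RegularKernel.zero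
  | insert a s ha ih =>
    simp only [Finset.sum_insert ha]
    exact (h a (Finset.mem_insert_self _ _)).add
      (ih fun i hi => h i (Finset.mem_insert_of_mem hi))

end RegularSums

/-! ### Kernels given by random features -/

section Features

variable {X B : Type} [MeasurableSpace X] [MeasurableSpace B] {μ : Measure X} [IsFiniteMeasure μ]
  {ν : Measure B} [IsFiniteMeasure ν] {φ : B → X → ℝ} {C : ℝ}

theorem measurable_feature_kernel (hφ : Measurable (Function.uncurry φ)) :
    Measurable (Function.uncurry fun x y => ∫ b, φ b x * φ b y ∂ν) := by
  have : StronglyMeasurable (Function.uncurry fun (p : X × X) b => φ b p.1 * φ b p.2) := by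
    refine Measurable.stronglyMeasurable ?_
    exact (hφ.comp (measurable_snd.prodMk (measurable_fst.comp measurable_fst))).mul
      (hφ.comp (measurable_snd.prodMk (measurable_snd.comp measurable_fst)))
  exact this.integral_prod_right.measurable

theorem integrable_feature (hφ : Measurable (Function.uncurry φ))
    (hC : ∀ᵐ p ∂(ν.prod μ), |φ p.1 p.2| ≤ C) {e : X → ℝ} (he : Integrable e μ) :
    Integrable (fun p : B × X => e p.2 * φ p.1 p.2) (ν.prod μ) :=
  (he.comp_snd ν).mul_bdd hφ.aestronglyMeasurable hC

theorem integral_feature_operator (hφ : Measurable (Function.uncurry φ))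
    (hC : ∀ᵐ p ∂(ν.prod μ), |φ p.1 p.2| ≤ C) {x : X} {C' : ℝ} (hx : ∀ᵐ b ∂ν, |φ b x| ≤ C')
    {e : X → ℝ} (he : Integrable e μ) :
    ∫ y, e y * ∫ b, φ b y * φ b x ∂ν ∂μ = ∫ b, φ b x * ∫ y, e y * φ b y ∂μ ∂ν := by
  have hi : Integrable (fun p : B × X => (e p.2 * φ p.1 p.2) * φ p.1 x) (ν.prod μ) :=
    (integrable_feature hφ hC he).mul_bdd
      (hφ.comp (measurable_fst.prodMk measurable_const)).aestronglyMeasurable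
      (Measure.quasiMeasurePreserving_fst.ae hx)
  have := integral_integral_swap (f := fun b y => (e y * φ b y) * φ b x) hi
  calc _ = ∫ y, ∫ b, (e y * φ b y) * φ b x ∂ν ∂μ := by
        congr 1 with y
        rw [← integral_const_mul]
        congr 1 with b
        ring
    _ = ∫ b, ∫ y, (e y * φ b y) * φ b x ∂μ ∂ν := this.symm
    _ = _ := by
        congr 1 with b
        rw [integral_mul_const, mul_comm]

/-- Fubini writes the quadratic form as an integral of squared coefficients, ready for Parseval. -/
theorem integral_feature_quadratic (hφ : Measurable (Function.uncurry φ))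
    (hC : ∀ᵐ p ∂(ν.prod μ), |φ p.1 p.2| ≤ C) (hx : ∀ x, ∃ C', ∀ᵐ b ∂ν, |φ b x| ≤ C')
    {e : X → ℝ} (he : Integrable e μ) :
    ∫ x, e x * ∫ y, e y * ∫ b, φ b y * φ b x ∂ν ∂μ ∂μ = ∫ b, (∫ y, e y * φ b y ∂μ) ^ 2 ∂ν := by
  have hm : AEStronglyMeasurable (fun b => ∫ y, e y * φ b y ∂μ) ν :=
    (integrable_feature hφ hC he).1.integral_prod_right'
  have hb : ∀ᵐ b ∂ν, ‖∫ y, e y * φ b y ∂μ‖ ≤ (∫ y, |e y| ∂μ) * C := by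
    filter_upwards [Measure.ae_ae_of_ae_prod hC] with b hb
    rw [← integral_mul_const]
    refine norm_integral_le_of_norm_le (he.abs.mul_const C) ?_
    filter_upwards [hb] with y hy
    rw [norm_mul]
    exact mul_le_mul_of_nonneg_left hy (abs_nonneg _)
  have hi : Integrable (fun p : B × X => (e p.2 * φ p.1 p.2) * ∫ y, e y * φ p.1 y ∂μ)
      (ν.prod μ) :=
    (integrable_feature hφ hC he).mul_bdd hm.comp_fst
      (Measure.quasiMeasurePreserving_fst.ae hb)
  have := integral_integral_swap (f := fun b x => (e x * φ b x) * ∫ y, e y * φ b y ∂μ) hi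
  calc _ = ∫ x, ∫ b, (e x * φ b x) * ∫ y, e y * φ b y ∂μ ∂ν ∂μ := by
        congr 1 with x
        obtain ⟨C', hC'⟩ := hx x
        rw [integral_feature_operator hφ hC hC' he, ← integral_const_mul]
        congr 1 with b
        ring
    _ = ∫ b, ∫ x, (e x * φ b x) * ∫ y, e y * φ b y ∂μ ∂μ ∂ν := this.symm
    _ = _ := by
        congr 1 with b
        rw [integral_mul_const, sq]

/-- For almost every `b`, Parseval sums the squared coefficients of `φ b` to `‖φ b‖²`; integrating
over `b` gives the integral of the diagonal. -/
theorem hasSum_feature_trace [SecondCountableTopology (Lp ℝ 2 μ)]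
    (hφ : Measurable (Function.uncurry φ)) (hC : ∀ᵐ p ∂(ν.prod μ), |φ p.1 p.2| ≤ C) {ι : Type}
    (e : HilbertBasis ι ℝ (Lp ℝ 2 μ)) :
    HasSum (fun i => ∫ b, (∫ y, e i y * φ b y ∂μ) ^ 2 ∂ν) (∫ x, ∫ b, φ b x * φ b x ∂ν ∂μ) := by
  -- Distinct basis vectors are at distance `√2`, so the balls of radius `1/2` are disjoint, and
  -- second countability makes the index set countable, as the exchange of sum and integral
  -- requires.
  have hcount : Countable ι := by
    refine Pairwise.countable_of_isOpen_disjoint (s := fun i => Metric.ball (e i) (1 / 2)) ?_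
      (fun i => Metric.isOpen_ball) (fun i => ⟨_, Metric.mem_ball_self (by norm_num)⟩)
    intro i j hij
    refine Metric.ball_disjoint_ball ?_
    have h1 : ‖e i - e j‖ ^ 2 = 2 := by
      rw [norm_sub_sq_real, e.orthonormal.1, e.orthonormal.1, e.orthonormal.2 hij]
      norm_num
    rw [dist_eq_norm]
    nlinarith [norm_nonneg (e i - e j)]
  have he : ∀ i, Integrable (e i) μ := fun i => (Lp.memLp (e i)).integrable one_le_two
  have hm : ∀ i, AEStronglyMeasurable (fun b => (∫ y, e i y * φ b y ∂μ) ^ 2) ν := fun i =>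
    ((integrable_feature hφ hC (he i)).1.integral_prod_right').pow 2
  have hφφ : Integrable (fun p : B × X => φ p.1 p.2 * φ p.1 p.2) (ν.prod μ) := by
    have h1 : Integrable (fun p : B × X => φ p.1 p.2) (ν.prod μ) :=
      Integrable.of_bound hφ.aestronglyMeasurable C hC
    exact h1.mul_bdd hφ.aestronglyMeasurable hC
  have hP : ∀ᵐ b ∂ν, HasSum (fun i => (∫ y, e i y * φ b y ∂μ) ^ 2) (∫ y, φ b y * φ b y ∂μ) := by
    filter_upwards [Measure.ae_ae_of_ae_prod hC] with b hb
    have hL : MemLp (φ b) 2 μ :=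
      MemLp.of_bound (hφ.comp measurable_prodMk_left).aestronglyMeasurable C hb
    have := e.hasSum_inner_mul_inner (hL.toLp) (hL.toLp)
    rw [L2.inner_def] at this
    have h1 : ∫ y, φ b y * φ b y ∂μ = ∫ y, inner ℝ (hL.toLp _ y) (hL.toLp _ y) ∂μ := by
      refine integral_congr_ae ?_
      filter_upwards [hL.coeFn_toLp] with y hy
      rw [hy]
      simp [sq]
    have h2 : ∀ i, ∫ y, e i y * φ b y ∂μ = inner ℝ (e i) (hL.toLp _) := fun i => by
      rw [L2.inner_def]
      refine integral_congr_ae ?_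
      filter_upwards [hL.coeFn_toLp] with y hy
      rw [hy]
      simp [mul_comm]
    rw [h1]
    refine this.congr_fun fun i => ?_
    rw [h2, sq, real_inner_comm (e i)]
  rw [← integral_integral_swap (f := fun b x => φ b x * φ b x) hφφ]
  -- The terms are nonnegative, so they dominate themselves.
  refine hasSum_integral_of_dominated_convergence
    (fun i b => (∫ y, e i y * φ b y ∂μ) ^ 2) hm (fun i => ae_of_all _ fun b => ?_)
    (hP.mono fun b hb => hb.summable) ?_ hP
  · rw [Real.norm_of_nonneg (sq_nonneg _)]
  · exact hφφ.integral_prod_left.congr (hP.mono fun b hb => hb.tsum_eq.symm)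

/-- Random feature kernels are regular. -/
theorem RegularKernel.of_feature [SecondCountableTopology (Lp ℝ 2 μ)]
    (hφ : Measurable (Function.uncurry φ)) (hC : ∀ᵐ p ∂(ν.prod μ), |φ p.1 p.2| ≤ C)
    (hx : ∀ x, ∃ C', ∀ᵐ b ∂ν, |φ b x| ≤ C') :
    RegularKernel μ fun x y => ∫ b, φ b x * φ b y ∂ν := by
  have hm := measurable_feature_kernel (ν := ν) hφ
  have hx2 : ∀ x, MemLp (fun b => φ b x) 2 ν := fun x => by
    obtain ⟨C', hC'⟩ := hx x
    exact MemLp.of_bound (hφ.comp measurable_prodMk_right).aestronglyMeasurable C' hC'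
  have hpsd : (kernelMatrix fun x y => ∫ b, φ b x * φ b y ∂ν).PosSemidef := by
    refine kernelMatrix_posSemidef_of_inner (fun x => (hx2 x).toLp) fun x y => ?_
    rw [L2.inner_def]
    refine integral_congr_ae ?_
    filter_upwards [(hx2 x).coeFn_toLp, (hx2 y).coeFn_toLp] with b h1 h2
    rw [h1, h2]
    simp [mul_comm]
  have hdiag : ∀ᵐ x ∂μ, ∫ b, φ b x * φ b x ∂ν ≤ C * C * ν.real univ := by
    have hC' := (Measure.ae_ae_comm (p := fun b x => |φ b x| ≤ C) (measurableSet_le hφ.abs measurable_const)).1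
      (Measure.ae_ae_of_ae_prod hC)
    filter_upwards [hC'] with x hx
    have : ∀ᵐ b ∂ν, ‖φ b x * φ b x‖ ≤ C * C := by
      filter_upwards [hx] with b hb
      rw [norm_mul]
      exact mul_le_mul hb hb (abs_nonneg _) ((abs_nonneg _).trans hb)
    exact (le_abs_self _).trans (norm_integral_le_of_norm_le_const this)
  have : Fact (kernelMatrix fun x y => ∫ b, φ b x * φ b y ∂ν).PosSemidef := ⟨hpsd⟩
  have hml : ∀ x, Measurable fun y => ∫ b, φ b y * φ b x ∂ν := fun x =>
    hm.comp (measurable_id.prodMk measurable_const)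
  have hT := isIntegralOperator_toL2 hml hdiag
  refine ⟨hpsd, hm, ⟨_, hdiag⟩, ?_, fun ι e => ?_⟩
  · rw [hT.integralOperator_eq]
    exact (ContinuousLinearMap.isPositive_self_comp_adjoint _).isSelfAdjoint
  · convert hasSum_feature_trace hφ hC e using 1
    ext i
    rw [← integral_feature_quadratic hφ hC hx ((Lp.memLp (e i)).integrable one_le_two),
      L2.inner_def, hT.integralOperator_eq]
    refine integral_congr_ae ?_
    filter_upwards [hT (e i)] with x hx
    rw [hx]
    simp [mul_comm]

end Features

/-! ### Regularity of the tangent kernels -/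

section Tangent

variable {d : ℕ} {σ : ℝ → ℝ} {γ : ℝ}

/-- A measurable activation of linear growth with bounded derivative. -/
structure TameActivation (σ : ℝ → ℝ) : Prop where
  measurable : Measurable σ
  bound_deriv : ∀ u, |deriv σ u| ≤ 2
  growth : ∀ u, |σ u| ≤ 1 + |u|

theorem SmoothActivation.tame (h : SmoothActivation σ) : TameActivation σ :=
  ⟨h.differentiable.continuous.measurable, h.bound_deriv, h.growth⟩

theorem lipschitzWith_relu : LipschitzWith 1 relu := LipschitzWith.id.const_max 0

theorem tameActivation_relu : TameActivation relu where
  measurable := measurable_const.max measurable_id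
  bound_deriv u := by
    have := norm_deriv_le_of_lipschitz (x₀ := u) lipschitzWith_relu
    rw [Real.norm_eq_abs, NNReal.coe_one] at this
    linarith
  growth u := by
    rw [relu, abs_of_nonneg (le_max_left _ _)]
    exact max_le (by positivity) (by linarith [le_abs_self u])

/-- The tangent kernel of the input weight distribution `ν`. -/
def tangentKernel (σ : ℝ → ℝ) (γ : ℝ) (ν : Measure (E d)) (x x' : E d) : ℝ :=
  (∫ b, σ (inner ℝ b x) * σ (inner ℝ b x') ∂ν) +
    (inner ℝ x x' + γ ^ 2) * ∫ b, deriv σ (inner ℝ b x) * deriv σ (inner ℝ b x') ∂ν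

/-- Expanding `⟪x, x'⟫ + γ²` as `∑ x_i x'_i + γ · γ` splits the kernel into feature kernels, with
features `σ(⟪b, x⟫)` and `q(x) σ'(⟪b, x⟫)` for `q` a coordinate or the constant `γ`. A general `ν`
covers both the sphere and point masses. -/
theorem TameActivation.regularKernel (hσ : TameActivation σ) {𝒳 : Set (E d)} {μ : Measure 𝒳}
    [IsFiniteMeasure μ] (hμ : ∀ᵐ x : 𝒳 ∂μ, ‖(x : E d)‖ = 1) {ν : Measure (E d)} [IsFiniteMeasure ν]
    {R : ℝ} (hν : ∀ᵐ b ∂ν, ‖b‖ ≤ R) :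
    RegularKernel μ fun x x' : 𝒳 => tangentKernel σ γ ν x x' := by
  have : Fact ((2 : ℝ≥0∞) ≠ ∞) := ⟨by simp⟩
  have hin : Measurable fun p : E d × 𝒳 => (inner ℝ p.1 (p.2 : E d) : ℝ) :=
    measurable_fst.inner (measurable_subtype_coe.comp measurable_snd)
  have hν' := Measure.quasiMeasurePreserving_fst (μ := ν) (ν := μ) |>.ae hν
  have hμ' := Measure.quasiMeasurePreserving_snd (μ := ν) (ν := μ) |>.ae hμ
  have hσb : ∀ (b : E d) (x : 𝒳), ‖b‖ ≤ R → |σ (inner ℝ b (x : E d))| ≤ 1 + R * ‖(x : E d)‖ :=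
    fun b x hb => (hσ.growth _).trans (add_le_add_right ((abs_real_inner_le_norm _ _).trans
      (mul_le_mul_of_nonneg_right hb (norm_nonneg _))) _)
  have r0 : RegularKernel μ fun x x' : 𝒳 => ∫ b, σ (inner ℝ b (x : E d)) *
      σ (inner ℝ b (x' : E d)) ∂ν :=
    RegularKernel.of_feature (X := 𝒳) (φ := fun b x => σ (inner ℝ b (x : E d))) (C := 1 + R)
      (hσ.measurable.comp hin)
      (by
        filter_upwards [hν', hμ'] with p h1 h2
        simpa [h2] using hσb p.1 p.2 h1)
      fun x => ⟨_, hν.mono fun b hb => hσb b x hb⟩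
  have rq : ∀ (q : 𝒳 → ℝ), Measurable q → (∀ x : 𝒳, |q x| ≤ |γ| + ‖(x : E d)‖) →
      RegularKernel μ fun x x' : 𝒳 => ∫ b, (q x * deriv σ (inner ℝ b (x : E d))) *
        (q x' * deriv σ (inner ℝ b (x' : E d))) ∂ν := fun q hq hqb => by
    have hb : ∀ (b : E d) (x : 𝒳), |q x * deriv σ (inner ℝ b (x : E d))| ≤
        (|γ| + ‖(x : E d)‖) * 2 := fun b x => by
      rw [abs_mul]
      exact mul_le_mul (hqb x) (hσ.bound_deriv _) (abs_nonneg _) (by positivity)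
    refine RegularKernel.of_feature (X := 𝒳) (φ := fun b x => q x * deriv σ (inner ℝ b (x : E d)))
      (C := (|γ| + 1) * 2) ((hq.comp measurable_snd).mul ((measurable_deriv σ).comp hin)) ?_
      fun x => ⟨_, ae_of_all _ fun b => hb b x⟩
    filter_upwards [hμ'] with p h2
    simpa [h2] using hb p.1 p.2
  have r1 := rq (fun _ => γ) measurable_const fun x => le_add_of_nonneg_right (norm_nonneg _)
  have r2 : ∀ i : Fin d, _ := fun i => rq (fun x => (x : E d) i)
    ((EuclideanSpace.proj (𝕜 := ℝ) i).continuous.measurable.comp measurable_subtype_coe)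
    fun x => (PiLp.norm_apply_le (x : E d) i).trans (le_add_of_nonneg_left (abs_nonneg _))
  convert (r0.add r1).add (RegularKernel.sum Finset.univ fun i _ => r2 i) using 3 with x x'
  have hq : ∀ a a' : ℝ, ∫ b, (a * deriv σ (inner ℝ b (x : E d))) *
      (a' * deriv σ (inner ℝ b (x' : E d))) ∂ν = a * a' *
      ∫ b, deriv σ (inner ℝ b (x : E d)) * deriv σ (inner ℝ b (x' : E d)) ∂ν := fun a a' => by
    rw [← integral_const_mul]
    exact integral_congr_ae (ae_of_all _ fun b => by ring)
  simp only [hq]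
  rw [← Finset.sum_mul, tangentKernel, PiLp.inner_apply]
  have : ∀ i, inner ℝ ((x : E d) i) ((x' : E d) i) = (x : E d) i * (x' : E d) i := fun i => by
    simp [mul_comm]
  simp only [this]
  ring

/-- The integrand of the tangent kernel. -/
def tangentIntegrand (σ : ℝ → ℝ) (γ : ℝ) (b : E d) (p : E d × E d) : ℝ :=
  σ (inner ℝ b p.1) * σ (inner ℝ b p.2) +
    (inner ℝ p.1 p.2 + γ ^ 2) * (deriv σ (inner ℝ b p.1) * deriv σ (inner ℝ b p.2))

/-- The two equal halves of the symmetric initialization cancel against `M = 2N`, leaving an average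
over the independent draws. -/
theorem kM_eq_sum_tangentIntegrand (𝒳 : Set (E d)) {N : ℕ} (w : Fin N → E d) (x x' : 𝒳) :
    kM 𝒳 σ γ w x x' = (∑ r, tangentIntegrand σ γ (w r) (x, x')) / N := by
  have h : kM 𝒳 σ γ w x x' =
      (∑ r, tangentIntegrand σ γ (symInit w r) (x, x')) / ((N + N : ℕ) : ℝ) := by
    simp only [kM, rfKernel, tangentIntegrand, Finset.sum_add_distrib, ← Finset.mul_sum]
    ring
  rw [h, Fin.sum_univ_add]
  simp only [symInit, Fin.append_left, Fin.append_right]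
  push_cast
  rw [← two_mul, ← two_mul]
  exact mul_div_mul_left _ _ two_ne_zero

theorem TameActivation.regularKernel_kM (hσ : TameActivation σ) {𝒳 : Set (E d)} {μ : Measure 𝒳}
    [IsFiniteMeasure μ] (hμ : ∀ᵐ x : 𝒳 ∂μ, ‖(x : E d)‖ = 1) {N : ℕ} (w : Fin N → E d) :
    RegularKernel μ (kM 𝒳 σ γ w) := by
  -- Each draw contributes the tangent kernel of a point mass `1 / N`. Here `w r` may lie off the
  -- sphere, so regularity holds for every outcome.
  have h : ∀ r, RegularKernel μ fun x x' : 𝒳 =>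
      tangentKernel σ γ ((N : ℝ≥0)⁻¹ • Measure.dirac (w r)) x x' := fun r =>
    hσ.regularKernel hμ (R := ‖w r‖) (Measure.ae_smul_measure (by simp) _)
  convert RegularKernel.sum Finset.univ fun r _ => h r with x x'
  rw [kM_eq_sum_tangentIntegrand, Finset.sum_div]
  refine Finset.sum_congr rfl fun r _ => ?_
  simp only [tangentKernel, tangentIntegrand, integral_smul_nnreal_measure, integral_dirac,
    NNReal.smul_def, NNReal.coe_inv, NNReal.coe_natCast, smul_eq_mul]
  ring

end Tangent

/-! ### The uniform distribution on the sphere -/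

section Sphere

variable {d : ℕ}

theorem ae_norm_uniformSphere : ∀ᵐ b ∂(uniformSphere d), ‖b‖ = 1 := by
  rw [uniformSphere, ae_map_iff measurable_subtype_coe.aemeasurable
    (measurableSet_eq_fun measurable_norm measurable_const)]
  exact ae_of_all _ fun b => by simp

open scoped Pointwise in
-- Surface measure is the volume of the cone over the set, so statements about the sphere reduce to
-- Lebesgue measure.
theorem uniformSphere_apply {A : Set (E d)} (hA : MeasurableSet A) :
    uniformSphere d A = ((volume : Measure (E d)).toSphere univ)⁻¹ * (d *
      volume {z : E d | 0 < ‖z‖ ∧ ‖z‖ < 1 ∧ ‖z‖⁻¹ • z ∈ A}) := by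
  rw [uniformSphere, Measure.map_apply measurable_subtype_coe hA, Measure.smul_apply,
    Measure.toSphere_apply' _ (measurable_subtype_coe hA), smul_eq_mul, finrank_euclideanSpace_fin]
  congr 3
  ext z
  simp only [Set.mem_smul, mem_image, mem_preimage, mem_ofPred_eq]
  constructor
  · rintro ⟨r, hr, _, ⟨b, hb, rfl⟩, rfl⟩
    have hb1 : ‖(b : E d)‖ = 1 := by simp
    rw [norm_smul, hb1, mul_one, Real.norm_of_nonneg hr.1.le, smul_smul,
      inv_mul_cancel₀ hr.1.ne', one_smul]
    exact ⟨hr.1, hr.2, hb⟩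
  · rintro ⟨h0, h1, hz⟩
    refine ⟨‖z‖, ⟨h0, h1⟩, ‖z‖⁻¹ • z, ⟨⟨‖z‖⁻¹ • z, ?_⟩, hz, rfl⟩, ?_⟩
    · simp [norm_smul, h0.ne']
    · simp only [smul_smul, mul_inv_cancel₀ h0.ne', one_smul]

theorem map_uniformSphere (R : E d ≃ₗᵢ[ℝ] E d) : (uniformSphere d).map R = uniformSphere d := by
  ext A hA
  have hR : Measurable R := R.continuous.measurable
  rw [Measure.map_apply hR hA, uniformSphere_apply (hR hA), uniformSphere_apply hA]
  congr 2
  have hm : MeasurableSet {z : E d | 0 < ‖z‖ ∧ ‖z‖ < 1 ∧ ‖z‖⁻¹ • z ∈ A} :=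
    (measurableSet_lt measurable_const measurable_norm).inter
      ((measurableSet_lt measurable_norm measurable_const).inter
        ((measurable_norm.inv.smul measurable_id) hA))
  rw [← R.measurePreserving.measure_preimage hm.nullMeasurableSet]
  congr 1
  ext z
  simp

/-- The law of `⟪b, x⟫` does not depend on the unit vector `x`. -/
theorem integral_inner_uniformSphere {h : ℝ → ℝ} {x e : E d} (hxe : ‖x‖ = ‖e‖) :
    ∫ b, h (inner ℝ b x) ∂(uniformSphere d) = ∫ b, h (inner ℝ b e) ∂(uniformSphere d) := by
  -- The reflection in the hyperplane orthogonal to `x - e` exchanges `x` and `e`.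
  set R := (ℝ ∙ (x - e))ᗮ.reflection
  have hR : R e = x := by
    rw [← Submodule.reflection_sub hxe, Submodule.reflection_reflection]
  conv_lhs => rw [← map_uniformSphere R]
  refine (R.toHomeomorph.measurableEmbedding.integral_map _).trans ?_
  refine integral_congr_ae (ae_of_all _ fun b => ?_)
  simp only [LinearIsometryEquiv.coe_toHomeomorph]
  rw [← hR, R.inner_map_map]

/-- The normalization map takes values in `(-1, 1)` and has the differentiable inverse `u ↦ q u /
√(1 - u²) - c` there; differentiable maps send null sets to null sets. -/
theorem volume_preimage_normalize_eq_zero {N : Set ℝ} (hN : volume N = 0) {c q : ℝ} (hq : 0 < q) :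
    volume {t : ℝ | (c + t) / √((c + t) ^ 2 + q ^ 2) ∈ N} = 0 := by
  have hsub : {t : ℝ | (c + t) / √((c + t) ^ 2 + q ^ 2) ∈ N} ⊆
      (fun u : ℝ => q * u / √(1 - u ^ 2) - c) '' (N ∩ Ioo (-1) 1) := by
    intro t ht
    set r := √((c + t) ^ 2 + q ^ 2) with hr
    have hpos : 0 < (c + t) ^ 2 + q ^ 2 := by positivity
    have hr0 : 0 < r := Real.sqrt_pos.2 hpos
    have hr2 : r ^ 2 = (c + t) ^ 2 + q ^ 2 := Real.sq_sqrt hpos.le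
    have h1 : 1 - ((c + t) / r) ^ 2 = (q / r) ^ 2 := by
      rw [div_pow, div_pow, hr2]
      field_simp
      ring
    refine ⟨(c + t) / r, ⟨ht, ?_⟩, ?_⟩
    · have h2 : 0 < (q / r) ^ 2 := by positivity
      exact abs_lt.1 ((sq_lt_one_iff_abs_lt_one _).1 (by linarith))
    · simp only
      rw [h1, Real.sqrt_sq (by positivity)]
      field_simp
      ring
  refine measure_mono_null hsub ?_
  refine addHaar_image_eq_zero_of_differentiableOn_of_addHaar_eq_zero _ (fun u hu => ?_)
    (measure_mono_null inter_subset_left hN)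
  have h2 : 0 < 1 - u ^ 2 := by nlinarith [hu.2.1, hu.2.2]
  refine DifferentiableAt.differentiableWithinAt ?_
  have h3 : DifferentiableAt ℝ (fun u : ℝ => √(1 - u ^ 2)) u :=
    DifferentiableAt.sqrt (by fun_prop) h2.ne'
  exact (DifferentiableAt.div (by fun_prop) h3 (Real.sqrt_pos.2 h2).ne').sub_const c

/-- The law of `⟪b, e⟫` is absolutely continuous. -/
theorem ae_inner_uniformSphere (hd : 2 ≤ d) {e : E d} (he : ‖e‖ = 1) {p : ℝ → Prop}
    (hp : ∀ᵐ u, p u) : ∀ᵐ b ∂(uniformSphere d), p (inner ℝ b e) := by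
  obtain ⟨N, hpN, hNm, hN0⟩ := exists_measurable_superset_of_null (ae_iff.1 hp)
  have hin : Measurable fun b : E d => (inner ℝ b e : ℝ) := measurable_id.inner measurable_const
  suffices h : uniformSphere d {b | (inner ℝ b e : ℝ) ∈ N} = 0 by
    refine ae_iff.2 (measure_mono_null (fun b hb => ?_) h)
    exact hpN hb
  rw [uniformSphere_apply (show MeasurableSet {b : E d | (inner ℝ b e : ℝ) ∈ N} from hin hNm)]
  have hm : MeasurableSet {z : E d | ‖z‖⁻¹ * inner ℝ z e ∉ N} :=
    (measurable_norm.inv.mul hin) hNm.compl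
  have hae : ∀ᵐ z : E d, z ∈ {z : E d | ‖z‖⁻¹ * inner ℝ z e ∉ N} := by
    -- Fubini along lines parallel to `e`.
    rw [← ae_ae_add_linearMap_mem_iff (LinearMap.toSpanSingleton ℝ (E d) e) volume volume hm]
    -- This is where `d ≥ 2` enters: the line through `e` is null, so almost every `y` has a nonzero
    -- component `v` orthogonal to `e`.
    have hs : (ℝ ∙ e) ≠ ⊤ := fun h => by
      have h1 := finrank_span_singleton (K := ℝ) (v := e) (by rintro rfl; simp at he)
      rw [h, finrank_top, finrank_euclideanSpace_fin] at h1
      omega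
    have h0 := measure_eq_zero_iff_ae_notMem.1
      (Measure.addHaar_submodule (volume : Measure (E d)) (ℝ ∙ e) hs)
    filter_upwards [h0] with y hy
    set c : ℝ := inner ℝ y e with hc
    set v := y - c • e with hv
    have hv0 : 0 < ‖v‖ := norm_pos_iff.2 fun h => hy (by
      rw [SetLike.mem_coe, Submodule.mem_span_singleton]
      exact ⟨c, (sub_eq_zero.1 h).symm⟩)
    have hve : inner ℝ v e = 0 := by
      rw [hv, inner_sub_left, real_inner_smul_left, real_inner_self_eq_norm_sq, he, ← hc]
      ring
    refine measure_eq_zero_iff_ae_notMem.1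
      (volume_preimage_normalize_eq_zero hN0 (c := c) hv0) |>.mono fun t ht => ?_
    have h1 : y + t • e = v + (c + t) • e := by rw [hv, add_smul]; abel
    have h2 : ‖y + t • e‖ = √((c + t) ^ 2 + ‖v‖ ^ 2) := by
      rw [h1, eq_comm, Real.sqrt_eq_iff_mul_self_eq (by positivity) (norm_nonneg _), ← sq,
        norm_add_sq_real, real_inner_smul_right, hve, norm_smul, he, mul_one, Real.norm_eq_abs,
        sq_abs]
      ring
    have h3 : inner ℝ (y + t • e) e = c + t := by
      rw [inner_add_left, real_inner_smul_left, real_inner_self_eq_norm_sq, he, ← hc]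
      ring
    simp only [LinearMap.toSpanSingleton_apply]
    rw [h2, h3, inv_mul_eq_div]
    exact ht
  have : volume {z : E d | 0 < ‖z‖ ∧ ‖z‖ < 1 ∧ ‖z‖⁻¹ • z ∈ {b : E d | (inner ℝ b e : ℝ) ∈ N}} = 0 := by
    refine measure_mono_null (fun z hz => ?_) (ae_iff.1 hae)
    have := hz.2.2
    simp only [mem_ofPred_eq, real_inner_smul_left] at this
    simpa using this
  rw [this]
  simp

end Sphere

/-! ### Convergence of the tangent kernels of smooth approximations -/

section Smoothing

variable {d : ℕ}

theorem abs_mul_sub_mul_le {a a' c c' C : ℝ} (ha' : |a'| ≤ C) (hc : |c| ≤ C) :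
    |a * a' - c * c'| ≤ C * |a - c| + C * |a' - c'| := by
  have h1 : a * a' - c * c' = a' * (a - c) + c * (a' - c') := by ring
  rw [h1]
  refine (abs_add_le _ _).trans (add_le_add ?_ ?_) <;> rw [abs_mul]
  · exact mul_le_mul_of_nonneg_right ha' (abs_nonneg _)
  · exact mul_le_mul_of_nonneg_right hc (abs_nonneg _)

variable [IsProbabilityMeasure (uniformSphere d)]

/-- The difference of products splits into two single-feature differences, and rotation invariance
moves both to a fixed `e`. The bound is thus uniform in `x, x'`. -/
theorem abs_integral_features_sub_le {f g : ℝ → ℝ} (hf : Measurable f) (hg : Measurable g) {C : ℝ}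
    (hfC : ∀ u, |u| ≤ 1 → |f u| ≤ C) (hgC : ∀ u, |u| ≤ 1 → |g u| ≤ C) {x x' e : E d}
    (hx : ‖x‖ = 1) (hx' : ‖x'‖ = 1) (he : ‖e‖ = 1) :
    |(∫ b, f (inner ℝ b x) * f (inner ℝ b x') ∂(uniformSphere d)) -
      ∫ b, g (inner ℝ b x) * g (inner ℝ b x') ∂(uniformSphere d)| ≤
    2 * C * ∫ b, |f (inner ℝ b e) - g (inner ℝ b e)| ∂(uniformSphere d) := by
  have hin : ∀ y : E d, Measurable fun b : E d => (inner ℝ b y : ℝ) := fun y =>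
    measurable_id.inner measurable_const
  have hle : ∀ y : E d, ‖y‖ = 1 → ∀ᵐ b ∂(uniformSphere d), |(inner ℝ b y : ℝ)| ≤ 1 := fun y hy => by
    filter_upwards [ae_norm_uniformSphere] with b hb
    simpa [hb, hy] using abs_real_inner_le_norm b y
  have hi : ∀ {h : ℝ → ℝ}, Measurable h → (∀ u, |u| ≤ 1 → |h u| ≤ C) → ∀ {y : E d}, ‖y‖ = 1 →
      Integrable (fun b => h (inner ℝ b y)) (uniformSphere d) := fun hh hC y hy =>
    Integrable.of_bound (hh.comp (hin y)).aestronglyMeasurable C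
      ((hle y hy).mono fun b hb => hC _ hb)
  have hii : ∀ {h : ℝ → ℝ}, Measurable h → (∀ u, |u| ≤ 1 → |h u| ≤ C) →
      Integrable (fun b => h (inner ℝ b x) * h (inner ℝ b x')) (uniformSphere d) := fun hh hC =>
    (hi hh hC hx).mul_bdd (hh.comp (hin x')).aestronglyMeasurable
      ((hle x' hx').mono fun b hb => hC _ hb)
  have hd : ∀ {y : E d}, ‖y‖ = 1 →
      Integrable (fun b => C * |f (inner ℝ b y) - g (inner ℝ b y)|) (uniformSphere d) := fun hy =>
    ((hi hf hfC hy).sub (hi hg hgC hy)).abs.const_mul C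
  rw [← integral_sub (hii hf hfC) (hii hg hgC)]
  refine abs_integral_le_integral_abs.trans ?_
  calc _ ≤ ∫ b, (C * |f (inner ℝ b x) - g (inner ℝ b x)| +
        C * |f (inner ℝ b x') - g (inner ℝ b x')|) ∂(uniformSphere d) := by
        refine integral_mono_of_nonneg (ae_of_all _ fun b => abs_nonneg _)
          ((hd hx).add (hd hx')) ?_
        filter_upwards [hle x hx, hle x' hx'] with b h1 h2
        exact abs_mul_sub_mul_le (hfC _ h2) (hgC _ h1)
    _ = _ := by
        rw [integral_add (hd hx) (hd hx'), integral_const_mul, integral_const_mul,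
          integral_inner_uniformSphere (h := fun u => |f u - g u|) (hx.trans he.symm),
          integral_inner_uniformSphere (h := fun u => |f u - g u|) (hx'.trans he.symm)]
        ring

theorem tendsto_integral_abs_sub {f : ℝ → ℝ → ℝ} {g : ℝ → ℝ} (hd : 2 ≤ d)
    (hf : ∀ s, 0 < s → Measurable (f s)) (hg : Measurable g) {C : ℝ}
    (hfC : ∀ s, 0 < s → ∀ u, |u| ≤ 1 → |f s u| ≤ C) (hgC : ∀ u, |u| ≤ 1 → |g u| ≤ C)
    (h : ∀ᵐ u : ℝ, Tendsto (fun s => f s u) atTop (𝓝 (g u))) {e : E d} (he : ‖e‖ = 1) :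
    Tendsto (fun s => ∫ b, |f s (inner ℝ b e) - g (inner ℝ b e)| ∂(uniformSphere d))
      atTop (𝓝 0) := by
  have hin : Measurable fun b : E d => (inner ℝ b e : ℝ) := measurable_id.inner measurable_const
  rw [← integral_zero (E d) ℝ (μ := uniformSphere d)]
  refine tendsto_integral_filter_of_dominated_convergence (fun _ => C + C) ?_ ?_
    (integrable_const _) ?_
  · filter_upwards [eventually_gt_atTop 0] with s hs
    exact (((hf s hs).comp hin).sub (hg.comp hin)).abs.aestronglyMeasurable
  · filter_upwards [eventually_gt_atTop 0] with s hs
    filter_upwards [ae_norm_uniformSphere] with b hb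
    have hle : |(inner ℝ b e : ℝ)| ≤ 1 := by simpa [hb, he] using abs_real_inner_le_norm b e
    rw [norm_abs_eq_norm]
    exact (abs_sub _ _).trans (add_le_add (hfC s hs _ hle) (hgC _ hle))
  · filter_upwards [ae_inner_uniformSphere hd he h] with b hb
    simpa using (hb.sub_const (g (inner ℝ b e))).abs

theorem TameActivation.abs_le_two {σ : ℝ → ℝ} (h : TameActivation σ) (u : ℝ) (hu : |u| ≤ 1) :
    |σ u| ≤ 2 := (h.growth u).trans (by linarith)

/-- The tangent kernels of the smooth approximations converge uniformly on the sphere. -/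
theorem SmoothReluApprox.tendsto_ntk (hd : 2 ≤ d) {σs : ℝ → ℝ → ℝ} (h : SmoothReluApprox σs)
    {γ : ℝ} (hγ : 0 < γ) (hγ' : γ ≤ 1) {ε : ℝ} (hε : 0 < ε) :
    ∀ᶠ s in atTop, 0 < s ∧ ∀ x x' : E d, ‖x‖ = 1 → ‖x'‖ = 1 →
      |ntk (σs s) γ x x' - ntk relu γ x x'| ≤ ε := by
  let e : E d := EuclideanSpace.single ⟨0, by omega⟩ 1
  have he : ‖e‖ = 1 := by simp [e]
  have t1 := tendsto_integral_abs_sub hd (C := 2) (fun s hs => (h.smooth s hs).tame.measurable)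
    tameActivation_relu.measurable (fun s hs => (h.smooth s hs).tame.abs_le_two)
    tameActivation_relu.abs_le_two h.tendsto he
  have t2 := tendsto_integral_abs_sub hd (C := 2) (fun s hs => measurable_deriv _)
    (measurable_deriv _) (fun s hs u _ => (h.smooth s hs).bound_deriv u)
    (fun u _ => tameActivation_relu.bound_deriv u) h.tendsto_deriv he
  -- Both features are bounded by `C = 2`, giving the factor `2 * C`; the extra `2` bounds `|⟪x, x'⟫
  -- + γ²|`.
  have t3 := (t1.const_mul (2 * 2)).add (t2.const_mul (2 * (2 * 2)))
  simp only [mul_zero, add_zero] at t3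
  filter_upwards [t3.eventually (gt_mem_nhds hε), eventually_gt_atTop 0] with s hs hs0
  refine ⟨hs0, fun x x' hx hx' => ?_⟩
  have b1 := abs_integral_features_sub_le (h.smooth s hs0).tame.measurable
    tameActivation_relu.measurable (h.smooth s hs0).tame.abs_le_two
    tameActivation_relu.abs_le_two hx hx' he
  have b2 := abs_integral_features_sub_le (measurable_deriv (σs s))
    (measurable_deriv relu) (fun u _ => (h.smooth s hs0).bound_deriv u)
    (fun u _ => tameActivation_relu.bound_deriv u) hx hx' he
  have b3 : |(inner ℝ x x' : ℝ) + γ ^ 2| ≤ 2 := by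
    have h1 := abs_real_inner_le_norm x x'
    rw [hx, hx', mul_one] at h1
    refine (abs_add_le _ _).trans ?_
    rw [abs_of_nonneg (sq_nonneg γ)]
    nlinarith
  rw [ntk, ntk, add_sub_add_comm, ← mul_sub]
  refine (abs_add_le _ _).trans ?_
  rw [abs_mul]
  refine le_trans (add_le_add b1 (mul_le_mul b3 b2 (abs_nonneg _) (by norm_num))) ?_
  linarith

end Smoothing

/-! ### A uniform weak law of large numbers -/

section UniformLaw

variable {Ω V : Type*} [MeasurableSpace Ω] {P : Measure Ω} [IsProbabilityMeasure P]
  [MeasurableSpace V] {ν : Measure V} {w : (N : ℕ) → Fin N → Ω → V}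

/-- The weak law of large numbers for a bounded function of triangular arrays of independent
identically distributed random variables. -/
theorem tendsto_measure_average_sub_integral [IsProbabilityMeasure ν]
    (hw_indep : ∀ N, iIndepFun (w N) P) (hw_law : ∀ N r, HasLaw (w N r) ν P) {g : V → ℝ}
    (hg : Measurable g) {C : ℝ} (hC : ∀ᵐ b ∂ν, |g b| ≤ C) {ε : ℝ} (hε : 0 < ε) :
    Tendsto (fun N => P {ω | ε ≤ |(∑ r, g (w N r ω)) / N - ∫ b, g b ∂ν|}) atTop (𝓝 0) := by
  have hgL : MemLp g 2 ν := MemLp.of_bound hg.aestronglyMeasurable C hC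
  have hmp : ∀ N r, AEMeasurable (w N r) P := fun N r => (hw_law N r).aemeasurable
  have hL : ∀ N r, MemLp (fun ω => g (w N r ω)) 2 P := fun N r => by
    rw [← (hw_law N r).map_eq] at hgL
    exact hgL.comp_of_map (hmp N r)
  have hmean : ∀ N r, ∫ ω, g (w N r ω) ∂P = ∫ b, g b ∂ν := fun N r => by
    rw [← (hw_law N r).map_eq, integral_map (hmp N r) hg.aestronglyMeasurable]
  have hvar : ∀ N r, Var[fun ω => g (w N r ω); P] = Var[g; ν] := fun N r => by
    rw [← (hw_law N r).map_eq, variance_map hg.aemeasurable (hmp N r)]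
    rfl
  have hbound : ∀ N : ℕ, 0 < N → P {ω | ε ≤ |(∑ r, g (w N r ω)) / N - ∫ b, g b ∂ν|} ≤
      ENNReal.ofReal (Var[g; ν] / ε ^ 2 / N) := fun N hN => by
    have hN' : (0 : ℝ) < N := Nat.cast_pos.2 hN
    have hS : MemLp (∑ r, fun ω => g (w N r ω)) 2 P := memLp_finsetSum' _ fun r _ => hL N r
    -- Chebyshev for the unnormalized sum at level `N ε`.
    have h1 := meas_ge_le_variance_div_sq hS (mul_pos hN' hε)
    have h2 : Var[∑ r, fun ω => g (w N r ω); P] = N * Var[g; ν] := by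
      rw [IndepFun.variance_sum (fun r _ => hL N r)]
      · simp [hvar]
      · intro i _ j _ hij
        exact ((hw_indep N).indepFun hij).comp hg hg
    have h3 : ∫ ω, (∑ r, fun ω => g (w N r ω)) ω ∂P = N * ∫ b, g b ∂ν := by
      simp only [Finset.sum_apply]
      rw [integral_finsetSum _ fun r _ => (hL N r).integrable one_le_two]
      simp [hmean]
    rw [h2, h3] at h1
    refine le_trans (measure_mono fun ω hω => ?_) (h1.trans_eq ?_)
    · simp only [mem_ofPred_eq, Finset.sum_apply] at hω ⊢
      have h4 : (∑ r, g (w N r ω)) - N * ∫ b, g b ∂ν =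
          N * ((∑ r, g (w N r ω)) / N - ∫ b, g b ∂ν) := by field_simp
      rw [h4, abs_mul, abs_of_pos hN']
      exact mul_le_mul_of_nonneg_left hω hN'.le
    · congr 1
      field_simp
  have hlim : Tendsto (fun N : ℕ => ENNReal.ofReal (Var[g; ν] / ε ^ 2 / N)) atTop (𝓝 0) := by
    rw [← ENNReal.ofReal_zero]
    exact ENNReal.tendsto_ofReal (tendsto_const_div_atTop_nhds_zero_nat _)
  exact tendsto_of_tendsto_of_tendsto_of_le_of_le' tendsto_const_nhds hlim
    (Eventually.of_forall fun _ => zero_le) ((eventually_gt_atTop 0).mono hbound)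

/-- The weak law of large numbers, uniformly over a compact family of continuous functions on a
compact set that carries the distribution. -/
theorem tendsto_measure_uniform_average [TopologicalSpace V] [BorelSpace V] {U : Type*}
    [TopologicalSpace U] [IsProbabilityMeasure ν]
    (hw_indep : ∀ N, iIndepFun (w N) P) (hw_law : ∀ N r, HasLaw (w N r) ν P)
    {F : V → U → ℝ} (hF : Continuous (Function.uncurry F)) {S : Set V} (hS : IsCompact S)
    (hνS : ∀ᵐ b ∂ν, b ∈ S) {Q : Set U} (hQ : IsCompact Q) {ε : ℝ}
    (hε : 0 < ε) :
    Tendsto (fun N => P {ω | ¬ ∀ q ∈ Q, |(∑ r, F (w N r ω) q) / N - ∫ b, F b q ∂ν| ≤ ε})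
      atTop (𝓝 0) := by
  have : CompactSpace S := isCompact_iff_compactSpace.1 hS
  -- Currying makes `q ↦ F(·, q)` continuous into the sup norm on `S`, so the image of `Q` is
  -- compact and has a finite `ε/4`-net.
  let Φ : C(U, C(S, ℝ)) := ContinuousMap.curry
    ⟨fun p : U × S => F p.2 p.1, hF.comp ((continuous_subtype_val.comp continuous_snd).prodMk
      continuous_fst)⟩
  have hFm : ∀ q, Measurable fun b => F b q := fun q =>
    (hF.comp (continuous_id.prodMk continuous_const)).measurable
  have hFb : ∀ q, ∀ᵐ b ∂ν, |F b q| ≤ ‖Φ q‖ := fun q =>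
    hνS.mono fun b hb => (Φ q).norm_coe_le_norm ⟨b, hb⟩
  have hFi : ∀ q, Integrable (fun b => F b q) ν := fun q =>
    Integrable.of_bound (hFm q).aestronglyMeasurable _ (hFb q)
  obtain ⟨T, -, hTf, ht⟩ := exists_subset_image_finite_and.1
    ((hQ.image Φ.continuous).finite_cover_balls (show 0 < ε / 4 by positivity))
  have hlim : Tendsto (fun N => ∑ q ∈ hTf.toFinset,
      P {ω | ε / 4 ≤ |(∑ r, F (w N r ω) q) / N - ∫ b, F b q ∂ν|}) atTop (𝓝 0) := by
    rw [← Finset.sum_const_zero (s := hTf.toFinset)]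
    exact tendsto_finsetSum _ fun q _ => tendsto_measure_average_sub_integral hw_indep hw_law
      (hFm q) (hFb q) (by positivity)
  refine tendsto_of_tendsto_of_tendsto_of_le_of_le tendsto_const_nhds hlim
    (fun _ => zero_le) fun N => ?_
  have hwS : ∀ᵐ ω ∂P, ∀ r, w N r ω ∈ S := by
    rw [ae_all_iff]
    intro r
    have := hνS
    rw [← (hw_law N r).map_eq] at this
    exact ae_of_ae_map (hw_law N r).aemeasurable this
  refine le_trans (measure_mono_ae ?_) (measure_biUnion_finset_le _ _)
  filter_upwards [hwS] with ω hω hbad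
  by_contra hgood
  refine hbad fun q hq => ?_
  obtain ⟨_, ⟨q', hq'T, rfl⟩, hqq'⟩ := mem_iUnion₂.1 (ht (mem_image_of_mem Φ hq))
  rw [Metric.mem_ball, dist_eq_norm] at hqq'
  have hclose : ∀ b ∈ S, |F b q - F b q'| ≤ ε / 4 := fun b hb =>
    ((Φ q - Φ q').norm_coe_le_norm ⟨b, hb⟩).trans hqq'.le
  have h1 : |(∑ r, F (w N r ω) q') / N - ∫ b, F b q' ∂ν| ≤ ε / 4 := by
    by_contra hcon
    refine hgood (mem_iUnion₂.2 ⟨q', hTf.mem_toFinset.2 hq'T, ?_⟩)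
    exact (not_le.1 hcon).le
  have h2 : |(∑ r, F (w N r ω) q) / N - (∑ r, F (w N r ω) q') / N| ≤ ε / 4 := by
    rw [← sub_div, ← Finset.sum_sub_distrib, abs_div, Nat.abs_cast]
    refine div_le_of_le_mul₀ (Nat.cast_nonneg _) (by positivity) ?_
    refine (Finset.abs_sum_le_sum_abs _ _).trans ?_
    refine (Finset.sum_le_card_nsmul _ _ _ fun r _ => hclose _ (hω r)).trans_eq ?_
    simp [mul_comm]
  have h3 : |(∫ b, F b q ∂ν) - ∫ b, F b q' ∂ν| ≤ ε / 4 := by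
    rw [← integral_sub (hFi q) (hFi q')]
    have := norm_integral_le_of_norm_le_const (μ := ν) (f := fun b => F b q - F b q')
      (hνS.mono hclose)
    simpa using this
  -- Net error for the average, deviation at the net point and net error for the integral add up to
  -- `3ε/4`.
  rw [abs_le] at *
  constructor <;> linarith [h1.1, h1.2, h2.1, h2.2, h3.1, h3.2]

end UniformLaw

/-! ### From uniform closeness of kernels to the limit statements. -/

section Convergence

variable {d : ℕ}

theorem SmoothActivation.continuous_tangentIntegrand {σ : ℝ → ℝ} (h : SmoothActivation σ) (γ : ℝ) :
    Continuous (Function.uncurry (tangentIntegrand (d := d) σ γ)) := by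
  have h1 := h.differentiable.continuous
  have h2 := h.differentiable_deriv.continuous
  unfold tangentIntegrand Function.uncurry
  fun_prop

theorem SmoothActivation.ntk_eq_integral [IsProbabilityMeasure (uniformSphere d)] {σ : ℝ → ℝ}
    (h : SmoothActivation σ) (γ : ℝ) {x x' : E d} (hx : ‖x‖ = 1) (hx' : ‖x'‖ = 1) :
    ntk σ γ x x' = ∫ b, tangentIntegrand σ γ b (x, x') ∂(uniformSphere d) := by
  have hle : ∀ y : E d, ‖y‖ = 1 → ∀ᵐ b ∂(uniformSphere d), |(inner ℝ b y : ℝ)| ≤ 1 := fun y hy => by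
    filter_upwards [ae_norm_uniformSphere] with b hb
    simpa [hb, hy] using abs_real_inner_le_norm b y
  have h1 := h.differentiable.continuous
  have h2 := h.differentiable_deriv.continuous
  have hi : ∀ {f : ℝ → ℝ}, Continuous f → (∀ u, |u| ≤ 1 → |f u| ≤ 2) →
      Integrable (fun b => f (inner ℝ b x) * f (inner ℝ b x')) (uniformSphere d) := fun hf hb => by
    refine Integrable.of_bound (Continuous.aestronglyMeasurable (by fun_prop)) (2 * 2) ?_
    filter_upwards [hle x hx, hle x' hx'] with b hb1 hb2
    rw [norm_mul]
    exact mul_le_mul (hb _ hb1) (hb _ hb2) (norm_nonneg _) zero_le_two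
  simp only [tangentIntegrand]
  rw [integral_add (hi h1 h.tame.abs_le_two)
    ((hi h2 fun u _ => h.bound_deriv u).const_mul _), integral_const_mul, ntk]

theorem exists_pos_ofReal_mul_lt (C : ℝ) {δ : ℝ≥0∞} (hδ : 0 < δ) :
    ∃ ε : ℝ, ENNReal.ofReal (C * ε) < δ ∧ 0 < ε := by
  have h1 : Tendsto (fun ε => ENNReal.ofReal (C * ε)) (𝓝[>] 0) (𝓝 0) := by
    have : Tendsto (fun ε => ENNReal.ofReal (C * ε)) (𝓝 0) (𝓝 (ENNReal.ofReal (C * 0))) :=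
      ENNReal.tendsto_ofReal (tendsto_id.const_mul C)
    rw [mul_zero, ENNReal.ofReal_zero] at this
    exact this.mono_left nhdsWithin_le_nhds
  exact ((h1.eventually (gt_mem_nhds hδ)).and self_mem_nhdsWithin).exists

/-- Convergence in probability follows from a bound in terms of the deviation `ε` on events of
probability tending to one. -/
theorem PlimZero.of_le {Ω : Type*} [MeasurableSpace Ω] {P : Measure Ω} {f : ℕ → Ω → ℝ≥0∞}
    {A : ℝ → ℕ → Ω → Prop} (hA : ∀ ε, 0 < ε → Tendsto (fun N => P {ω | ¬ A ε N ω}) atTop (𝓝 0))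
    {C : ℝ} (hf : ∀ ε, 0 < ε → ∀ N ω, A ε N ω → f N ω ≤ ENNReal.ofReal (C * ε)) :
    PlimZero P f := by
  intro δ hδ
  obtain ⟨ε, hε, hε0⟩ := exists_pos_ofReal_mul_lt C hδ
  refine tendsto_of_tendsto_of_tendsto_of_le_of_le tendsto_const_nhds (hA ε hε0)
    (fun _ => zero_le) fun N => measure_mono fun ω hω hAω => ?_
  exact (hε.trans_le hω).not_ge (hf ε hε0 N ω hAω)

theorem tendsto_zero_of_le {f : ℝ → ℝ≥0∞} {A : ℝ → ℝ → Prop}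
    (hA : ∀ ε, 0 < ε → ∀ᶠ s in atTop, A ε s) {C : ℝ}
    (hf : ∀ ε, 0 < ε → ∀ s, A ε s → f s ≤ ENNReal.ofReal (C * ε)) : Tendsto f atTop (𝓝 0) := by
  rw [ENNReal.tendsto_nhds_zero]
  intro δ hδ
  obtain ⟨ε, hε, hε0⟩ := exists_pos_ofReal_mul_lt C hδ
  exact (hA ε hε0).mono fun s hs => (hf ε hε0 s hs).trans hε.le

/-- On `[-1, 1]` both `σ` and `σ'` are bounded by `2`, so each integral is at most `4`, and `1 + γ²
≤ 2` gives `4 + 2 · 4`. -/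
theorem TameActivation.ntk_diag_le [IsProbabilityMeasure (uniformSphere d)] {σ : ℝ → ℝ}
    (h : TameActivation σ) {γ : ℝ} (hγ : 0 < γ) (hγ' : γ ≤ 1) {x : E d} (hx : ‖x‖ = 1) :
    ntk σ γ x x ≤ 12 := by
  have hb : ∀ {f : ℝ → ℝ}, (∀ u, |u| ≤ 1 → |f u| ≤ 2) →
      ∫ b, f (inner ℝ b x) * f (inner ℝ b x) ∂(uniformSphere d) ≤ 4 := fun {f} hf => by
    have : ∀ᵐ b ∂(uniformSphere d), ‖f (inner ℝ b x) * f (inner ℝ b x)‖ ≤ 4 := by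
      filter_upwards [ae_norm_uniformSphere] with b hb
      have h1 : |(inner ℝ b x : ℝ)| ≤ 1 := by simpa [hb, hx] using abs_real_inner_le_norm b x
      have h2 := hf _ h1
      rw [norm_mul, Real.norm_eq_abs]
      nlinarith [abs_nonneg (f (inner ℝ b x))]
    simpa using (le_abs_self _).trans (norm_integral_le_of_norm_le_const this)
  have h1 := hb h.abs_le_two
  have h2 := hb (f := deriv σ) fun u _ => h.bound_deriv u
  have h3 : 0 ≤ ∫ b, deriv σ (inner ℝ b x) * deriv σ (inner ℝ b x) ∂(uniformSphere d) :=
    integral_nonneg fun b => mul_self_nonneg _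
  rw [ntk, real_inner_self_eq_norm_sq, hx]
  nlinarith

end Convergence

end NTK

end

theorem propositionE {d : ℕ} (hd : 2 ≤ d)
    -- feature space, label space and data distribution, with uniform marginal on the sphere
    (𝒳 : Set (NTK.E d)) (h𝒳 : MeasurableSet 𝒳)
    (𝒴 : Set ℝ) (h𝒴 : MeasurableSet 𝒴) (h𝒴' : 𝒴 ⊆ Set.Icc (-1) 1)
    (ρ : Measure (𝒳 × 𝒴)) [IsProbabilityMeasure ρ]
    (hρ : ρ.fst.map (Subtype.val : 𝒳 → NTK.E d) = NTK.uniformSphere d)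
    (γ : ℝ) (hγ : 0 < γ) (hγ' : γ ≤ 1)
    -- smooth approximation of the ReLU
    (σs : ℝ → ℝ → ℝ) (hσs : NTK.SmoothReluApprox σs)
    -- regularization parameter
    (lam : ℝ) (hlam : 0 < lam)
    -- for each width `M = N + N`, the `N` independent draws that determine the initialization
    {Ω : Type*} [MeasurableSpace Ω] (P : Measure Ω) [IsProbabilityMeasure P]
    (w : (N : ℕ) → Fin N → Ω → NTK.E d)
    (hw_indep : ∀ N, iIndepFun (w N) P)
    (hw_law : ∀ N r, HasLaw (w N r) (NTK.uniformSphere d) P) :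
    -- the operators, their traces and the minimizers are well defined
    ((∀ s, 0 < s → ∀ N ω, NTK.WellPosed (NTK.kM 𝒳 (σs s) γ fun r => w N r ω) ρ lam) ∧
      (∀ s, 0 < s → NTK.WellPosed (NTK.kInf 𝒳 (σs s) γ) ρ lam) ∧
      NTK.WellPosed (NTK.kInf 𝒳 NTK.relu γ) ρ lam) ∧
    -- convergence of the kernels
    ((∀ s, 0 < s → NTK.PlimZero P fun N ω =>
        NTK.kernelDist ρ.fst (NTK.kM 𝒳 (σs s) γ fun r => w N r ω) (NTK.kInf 𝒳 (σs s) γ)) ∧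
      Tendsto (fun s => NTK.kernelDist ρ.fst (NTK.kInf 𝒳 (σs s) γ) (NTK.kInf 𝒳 NTK.relu γ))
        atTop (𝓝 0)) ∧
    -- convergence of the traces of the integral operators
    ((∀ s, 0 < s → NTK.PlimZero P fun N ω =>
        NTK.traceDist ρ.fst (NTK.kM 𝒳 (σs s) γ fun r => w N r ω) (NTK.kInf 𝒳 (σs s) γ)) ∧
      Tendsto (fun s => NTK.traceDist ρ.fst (NTK.kInf 𝒳 (σs s) γ) (NTK.kInf 𝒳 NTK.relu γ))
        atTop (𝓝 0)) ∧
    -- convergence of the regularized minimizers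
    ((∀ s, 0 < s → NTK.PlimZero P fun N ω =>
        NTK.minimizerDist ρ lam (NTK.kM 𝒳 (σs s) γ fun r => w N r ω) (NTK.kInf 𝒳 (σs s) γ)) ∧
      Tendsto (fun s => NTK.minimizerDist ρ lam (NTK.kInf 𝒳 (σs s) γ) (NTK.kInf 𝒳 NTK.relu γ))
        atTop (𝓝 0)) := by
  -- The normalization is inherited from `ρ`, avoiding any computation of the surface area.
  have hμ0 : IsProbabilityMeasure (NTK.uniformSphere d) := by
    rw [← hρ]
    exact Measure.isProbabilityMeasure_map measurable_subtype_coe.aemeasurable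
  have hG : ∀ᵐ x : 𝒳 ∂ρ.fst, ‖(x : NTK.E d)‖ = 1 := by
    have h := NTK.ae_norm_uniformSphere (d := d)
    rw [← hρ] at h
    exact ae_of_ae_map measurable_subtype_coe.aemeasurable h
  have rInf : ∀ {σ : ℝ → ℝ}, NTK.TameActivation σ →
      NTK.RegularKernel ρ.fst (NTK.kInf 𝒳 σ γ) := fun hσ =>
    hσ.regularKernel hG (NTK.ae_norm_uniformSphere.mono fun b hb => hb.le)
  have dInf : ∀ {σ : ℝ → ℝ}, NTK.TameActivation σ → ∀ x : 𝒳, ‖(x : NTK.E d)‖ = 1 →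
      NTK.kInf 𝒳 σ γ x x ≤ 12 := fun hσ x hx => hσ.ntk_diag_le hγ hγ' hx
  have tame := fun s hs => (hσs.smooth s hs).tame
  have rM := fun s hs N ω => (tame s hs).regularKernel_kM (γ := γ) hG fun r => w N r ω
  have hM : ∀ s, 0 < s → ∀ ε, 0 < ε → Tendsto (fun N => P {ω | ¬ ∀ x x' : 𝒳,
      ‖(x : NTK.E d)‖ = 1 → ‖(x' : NTK.E d)‖ = 1 →
      |NTK.kM 𝒳 (σs s) γ (fun r => w N r ω) x x' - NTK.kInf 𝒳 (σs s) γ x x'| ≤ ε})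
      atTop (𝓝 0) := fun s hs ε hε => by
    have hcomp : IsCompact (Metric.sphere (0 : NTK.E d) 1) := isCompact_sphere _ _
    refine tendsto_of_tendsto_of_tendsto_of_le_of_le tendsto_const_nhds
      (NTK.tendsto_measure_uniform_average hw_indep hw_law
        ((hσs.smooth s hs).continuous_tangentIntegrand γ) hcomp
        (by simpa using NTK.ae_norm_uniformSphere) (hcomp.prod hcomp) hε)
      (fun _ => zero_le) fun N => measure_mono fun ω hω hA => hω fun x x' hx hx' => ?_
    rw [NTK.kM_eq_sum_tangentIntegrand, NTK.kInf, (hσs.smooth s hs).ntk_eq_integral γ hx hx']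
    exact hA (x, x') ⟨by simpa using hx, by simpa using hx'⟩
  have hInf := fun ε hε => hσs.tendsto_ntk hd hγ hγ' (ε := ε) hε
  refine ⟨⟨fun s hs N ω => (rM s hs N ω).wellPosed h𝒴' hlam,
    fun s hs => (rInf (tame s hs)).wellPosed h𝒴' hlam,
    (rInf NTK.tameActivation_relu).wellPosed h𝒴' hlam⟩, ⟨fun s hs => ?_, ?_⟩,
    ⟨fun s hs => ?_, ?_⟩, ⟨fun s hs => ?_, ?_⟩⟩
  · refine NTK.PlimZero.of_le (hM s hs) (C := 1) fun ε _ N ω hA => ?_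
    rw [one_mul]
    exact NTK.kernelDist_le hG fun x x' hx hx' => hA x x' hx hx'
  · refine NTK.tendsto_zero_of_le hInf (C := 1) fun ε _ s hA => ?_
    rw [one_mul]
    exact NTK.kernelDist_le hG fun x x' hx hx' => hA.2 x x' hx hx'
  · refine NTK.PlimZero.of_le (hM s hs) (C := 1) fun ε _ N ω hA => ?_
    rw [one_mul]
    exact (rM s hs N ω).traceDist_le (rInf (tame s hs)) hG fun x x' hx hx' => hA x x' hx hx'
  · refine NTK.tendsto_zero_of_le hInf (C := 1) fun ε _ s hA => ?_
    rw [one_mul]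
    exact (rInf (tame s hA.1)).traceDist_le (rInf NTK.tameActivation_relu) hG
      fun x x' hx hx' => hA.2 x x' hx hx'
  -- The constant left implicit is `(1 + 12 / lam) / lam`, independent of `N`, `ω` and `s`.
  · exact NTK.PlimZero.of_le (hM s hs) fun ε _ N ω hA =>
      (rM s hs N ω).minimizerDist_le (rInf (tame s hs)) h𝒴' hlam hG (dInf (tame s hs))
        fun x x' hx hx' => hA x x' hx hx'
  · exact NTK.tendsto_zero_of_le hInf fun ε _ s hA =>
      (rInf (tame s hA.1)).minimizerDist_le (rInf NTK.tameActivation_relu) h𝒴' hlam hG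
        (dInf NTK.tameActivation_relu) fun x x' hx hx' => hA.2 x x' hx hx'
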